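/- Let $D\subset\mathbb R^d$ be a nonempty convex (possibly unbounded) open set, let $\Pi(x)$ denote the projection of $x\in\mathbb R^d$ on $\bar D$, and let $\mathbb D(\mathbb R^+,\mathbb R^k)$ be the space of right-continuous functions with left limits from $\mathbb R^+=[0,\infty)$ to $\mathbb R^k$, equipped with the Skorokhod topology $J_1$. All processes below are $d$-dimensional with trajectories in $\mathbb D(\mathbb R^+,\mathbb R^d)$; processes with index $n$ are defined on a probability space with probability $P^n$, which may depend on $n$. For $x,z\in\mathbb D(\mathbb R^+,\mathbb R^d)$, $\delta>0$, $q\in\mathbb R^+$ put $$\bar\omega''_{(x,z)}(\delta,q)=\sup\{\min(|x_u-x_s|,|z_t-z_u|):\ 0\le s<u<t\le q,\ t-s<\delta\}.$$ For $n\in\mathbb N=\{1,2,\dots\}$ let $Y^n$ be a process with $Y^n_0\in\bar D$ almost surely, and let the process $X^n$ satisfy, almost surely, $$X^n_t=Y^n_t-n\int_0^t\bigl(X^n_s-\Pi(X^n_s)\bigr)\,ds,\qquad t\in\mathbb R^+ .$$ (i) For any sequence of processes $\{Z^n\}$, if $\{(Y^n,Z^n)\}$ is tight in $\mathbb D(\mathbb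 R^+,\mathbb R^{2d})$, then for every $\varepsilon>0$ and $q\in\mathbb R^+$ $$\lim_{\delta\downarrow0}\limsup_{n\to\infty}P^n\bigl(\bar\omega''_{(X^n,Z^n)}(\delta,q)>\varepsilon\bigr)=0 .$$ (ii) Let $\{H^n\}$, $\{Z^n\}$ be any sequences of processes such that $(Y^n,H^n,Z^n)\to(Y,H,Z)$ in law in $\mathbb D(\mathbb R^+,\mathbb R^{3d})$, where $Y,H,Z$ are processes on a probability space with probability $P$, and let $X=Y+K$ be a process on that space such that, almost surely, $(X,K)$ is a solution of the Skorokhod problem on $D$ associated with $Y$. Then $$(\Pi(X^n),H^n,Z^n)\to(X,H,Z)\quad\text{in law in }\mathbb D(\mathbb R^+,\mathbb R^{3d}),$$ and $$(X^n_{t_1},\dots,X^n_{t_m},H^n,Z^n)\to(X_{t_1},\dots,X_{t_m},H,Z)\quad\text{in law in }(\mathbb R^{d})^m\times\mathbb D(\mathbb R^+,\mathbb R^{2d})$$ for any $m\in\mathbb N$ and any $t_1,\dots,t_m\in\mathbb R^+$ such that $P(|\Delta Y_{t_i}|=0)=1$ for $i=1,\dots,m$. Here $\Delta Y_t=Y_t-Y_{t-}$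 with $Y_{0-}=Y_0$. A pair $(x,k)$ of functions in $\mathbb D(\mathbb R^+,\mathbb R^d)$ is a solution of the Skorokhod problem on $D$ associated with $y\in\mathbb D(\mathbb R^+,\mathbb R^d)$ if $x_t=y_t+k_t$ and $x_t\in\bar D$ for all $t\in\mathbb R^+$, $k_0=0$, $k$ has locally bounded variation, and, with $|k|_t$ the total variation of $k$ on $[0,t]$ with respect to the Euclidean norm, $$k_t=\int_0^t\mathbf n_s\,d|k|_s,\qquad |k|_t=\int_0^t\mathbf 1_{\{x_s\in\partial D\}}\,d|k|_s,\qquad t\in\mathbb R^+,$$ where, whenever $x_s\in\partial D$, $\mathbf n_s$ is an inward normal unit vector at $x_s$, i.e. $|\mathbf n_s|=1$ and $\langle y'-x_s,\mathbf n_s\rangle\ge0$ for every $y'\in\bar D$. -/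

import Mathlib

open MeasureTheory ProbabilityTheory Filter Set Topology
open scoped NNReal ENNReal

/-- The space `𝔻(ℝ₊, E)`: functions `ℝ₊ → E` that are right-continuous with left limits. -/
structure Cadlag (E : Type*) [TopologicalSpace E] where
  toFun : ℝ≥0 → E
  right_continuous : ∀ t, ContinuousWithinAt toFun (Ici t) t
  left_limits : ∀ t, ∃ l, Tendsto toFun (𝓝[<] t) (𝓝 l)

namespace Cadlag

instance {E : Type*} [TopologicalSpace E] : CoeFun (Cadlag E) (fun _ => ℝ≥0 → E) := ⟨toFun⟩

/-- The composition `f ∘ x` with a continuous function `f`. -/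
def map {E F : Type*} [TopologicalSpace E] [TopologicalSpace F] (f : E → F) (hf : Continuous f)
    (x : Cadlag E) : Cadlag F where
  toFun t := f (x t)
  right_continuous t := hf.continuousAt.comp_continuousWithinAt (x.right_continuous t)
  left_limits t := by
    obtain ⟨l, hl⟩ := x.left_limits t
    exact ⟨f l, (hf.tendsto l).comp hl⟩

/-- The pair `(x, y)` as one càdlàg function with values in the product space. -/
def prodMk {E F : Type*} [TopologicalSpace E] [TopologicalSpace F]
    (x : Cadlag E) (y : Cadlag F) : Cadlag (E × F) where
  toFun t := (x t, y t)
  right_continuous t := (x.right_continuous t).prodMk (y.right_continuous t)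
  left_limits t := by
    obtain ⟨l, hl⟩ := x.left_limits t
    obtain ⟨m, hm⟩ := y.left_limits t
    exact ⟨(l, m), hl.prodMk_nhds hm⟩

/-- The jump `Δx_t = x_t - x_{t-}`, where `x_{0-} = x_0`. -/
noncomputable def jump {E : Type*} [TopologicalSpace E] [Sub E] (x : Cadlag E) (t : ℝ≥0) : E :=
  x t - Function.leftLim x t

/-- Basic `J₁`-neighbourhood of `x`: those `y` for which some time change `lam` (an increasing
bijection of `ℝ₊`) moves points by at most `ε` and makes `y ∘ lam` and `x` differ by at most `ε`
on `[0, N]`. -/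
def skorokhodNhd {E : Type*} [PseudoMetricSpace E] (x : Cadlag E) (N : ℝ≥0) (ε : ℝ) :
    Set (Cadlag E) :=
  {y | ∃ lam : ℝ≥0 ≃o ℝ≥0, (∀ s, dist (lam s) s ≤ ε) ∧ ∀ s ≤ N, dist (y (lam s)) (x s) ≤ ε}

/-- The Skorokhod topology `J₁`: a set is open iff with every point it contains a basic
neighbourhood of that point. -/
instance {E : Type*} [PseudoMetricSpace E] : TopologicalSpace (Cadlag E) where
  IsOpen U := ∀ x ∈ U, ∃ N : ℝ≥0, ∃ ε : ℝ, 0 < ε ∧ skorokhodNhd x N ε ⊆ U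
  isOpen_univ := fun _ _ => ⟨0, 1, one_pos, subset_univ _⟩
  isOpen_inter := by
    rintro U V hU hV x ⟨hxU, hxV⟩
    obtain ⟨N, ε, hε, h⟩ := hU x hxU
    obtain ⟨M, η, hη, h'⟩ := hV x hxV
    refine ⟨max N M, min ε η, lt_min hε hη, ?_⟩
    rintro y ⟨lam, h1, h2⟩
    exact ⟨h ⟨lam, fun s => (h1 s).trans (min_le_left _ _),
        fun s hs => (h2 s (hs.trans (le_max_left _ _))).trans (min_le_left _ _)⟩,
      h' ⟨lam, fun s => (h1 s).trans (min_le_right _ _),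
        fun s hs => (h2 s (hs.trans (le_max_right _ _))).trans (min_le_right _ _)⟩⟩
  isOpen_sUnion := by
    rintro S hS x ⟨U, hU, hx⟩
    obtain ⟨N, ε, hε, h⟩ := hS U hU x hx
    exact ⟨N, ε, hε, h.trans (subset_sUnion_of_mem hU)⟩

/-- `𝔻(ℝ₊, E)` carries the Borel `σ`-algebra of `J₁`. -/
instance {E : Type*} [PseudoMetricSpace E] : MeasurableSpace (Cadlag E) := borel _

instance {E : Type*} [PseudoMetricSpace E] : BorelSpace (Cadlag E) := ⟨rfl⟩

/-- The modulus
`ω̄''_{(x,y)}(δ, q) = sup {min (|x_u - x_s|, |y_t - y_u|) : 0 ≤ s < u < t ≤ q, t - s < δ}`,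
with values in `[0, ∞]`. -/
noncomputable def jakubowskiModulus {E F : Type*} [PseudoMetricSpace E] [PseudoMetricSpace F]
    (x : Cadlag E) (y : Cadlag F) (δ : ℝ) (q : ℝ≥0) : ℝ≥0∞ :=
  ⨆ (s : ℝ≥0) (u : ℝ≥0) (t : ℝ≥0) (_ : s < u ∧ u < t ∧ t ≤ q ∧ (t : ℝ) - s < δ),
    min (edist (x u) (x s)) (edist (y t) (y u))

end Cadlag

/-- Convergence in law `ξ n → ζ` of random elements of the topological space `S` with its Borel
`σ`-algebra; the `ξ n` and `ζ` may live on different probability spaces. -/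
def ConvergesInLaw {S : Type*} [TopologicalSpace S] {Ω : ℕ+ → Type*} {Ω' : Type*}
    [∀ n, MeasurableSpace (Ω n)] [MeasurableSpace Ω']
    (P : ∀ n, Measure (Ω n)) [∀ n, IsProbabilityMeasure (P n)]
    (P' : Measure Ω') [IsProbabilityMeasure P']
    (ξ : ∀ n, Ω n → S) (ζ : Ω' → S) : Prop :=
  letI : MeasurableSpace S := borel S
  haveI : BorelSpace S := ⟨rfl⟩
  TendstoInDistribution ξ atTop ζ P P'

/-- The `ξ n` are random elements of the topological space `S` with its Borel `σ`-algebra, and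
their laws form a tight family. -/
def IsTightSequence {S : Type*} [TopologicalSpace S] {Ω : ℕ+ → Type*}
    [∀ n, MeasurableSpace (Ω n)] (P : ∀ n, Measure (Ω n)) (ξ : ∀ n, Ω n → S) : Prop :=
  letI : MeasurableSpace S := borel S
  (∀ n, AEMeasurable (ξ n) (P n)) ∧ IsTightMeasureSet (range fun n => (P n).map (ξ n))

section Projection

variable {E : Type*} [NormedAddCommGroup E] [InnerProductSpace ℝ E]

/-- The projection `Π(x)` of `x` on `closure D`: a point of `closure D` at minimal distance
from `x`. -/
noncomputable def proj (D : Set E) (x : E) : E :=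
  Classical.epsilon fun p => p ∈ closure D ∧ ‖x - p‖ = Metric.infDist x (closure D)

theorem proj_spec [FiniteDimensional ℝ E] {D : Set E} (hne : D.Nonempty) (x : E) :
    proj D x ∈ closure D ∧ ‖x - proj D x‖ = Metric.infDist x (closure D) := by
  have : ProperSpace E := FiniteDimensional.proper ℝ E
  obtain ⟨p, hp, h⟩ := isClosed_closure.exists_infDist_eq_dist hne.closure x
  exact Classical.epsilon_spec
    (p := fun p => p ∈ closure D ∧ ‖x - p‖ = Metric.infDist x (closure D))
    ⟨p, hp, by rw [h, dist_eq_norm]⟩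

theorem proj_inner_le [FiniteDimensional ℝ E] {D : Set E} (hc : Convex ℝ D) (hne : D.Nonempty)
    (x w : E) (hw : w ∈ closure D) : inner ℝ (x - proj D x) (w - proj D x) ≤ 0 := by
  obtain ⟨h1, h2⟩ := proj_spec hne x
  refine (norm_eq_iInf_iff_real_inner_le_zero hc.closure h1).1 ?_ w hw
  rw [h2, Metric.infDist_eq_iInf]
  simp only [dist_eq_norm]

theorem continuous_proj [FiniteDimensional ℝ E] {D : Set E} (hc : Convex ℝ D)
    (hne : D.Nonempty) : Continuous (proj D) := by
  refine LipschitzWith.continuous (K := 1) (LipschitzWith.of_dist_le_mul fun x y => ?_)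
  have hx := proj_inner_le hc hne x _ (proj_spec hne y).1
  have hy := proj_inner_le hc hne y _ (proj_spec hne x).1
  rw [NNReal.coe_one, one_mul, dist_eq_norm, dist_eq_norm]
  set p := proj D x
  set r := proj D y
  have e1 : inner ℝ (x - p) (r - p) = - inner ℝ x (p - r) + inner ℝ p (p - r) := by
    simp only [inner_sub_left, inner_sub_right]; ring
  have e2 : inner ℝ (y - r) (p - r) = inner ℝ y (p - r) - inner ℝ r (p - r) := by
    simp only [inner_sub_left]
  have e3 : ‖p - r‖ * ‖p - r‖ = inner ℝ p (p - r) - inner ℝ r (p - r) := by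
    rw [← real_inner_self_eq_norm_mul_norm, inner_sub_left]
  have e4 : inner ℝ (x - y) (p - r) = inner ℝ x (p - r) - inner ℝ y (p - r) := by
    rw [inner_sub_left]
  have h := real_inner_le_norm (x - y) (p - r)
  have h0 := norm_nonneg (p - r)
  by_contra hlt
  push Not at hlt
  nlinarith [norm_nonneg (x - y)]

end Projection

section Equations

variable {d : ℕ}

/-- The set `𝒩_x` of inward normal unit vectors: `‖n‖ = 1` and `⟨y - x, n⟩ ≥ 0` for all
`y ∈ closure D`. -/
def inwardNormals (D : Set (EuclideanSpace ℝ (Fin d))) (x : EuclideanSpace ℝ (Fin d)) :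
    Set (EuclideanSpace ℝ (Fin d)) :=
  {n | ‖n‖ = 1 ∧ ∀ y ∈ closure D, 0 ≤ inner ℝ (y - x) n}

/-- `x` solves the equation with penalization term
`x_t = y_t - c ∫₀ᵗ (x_s - Π(x_s)) ds` for all `t ≥ 0`. -/
def IsPenalizedSolution (D : Set (EuclideanSpace ℝ (Fin d))) (c : ℝ)
    (y x : Cadlag (EuclideanSpace ℝ (Fin d))) : Prop :=
  ∀ t : ℝ≥0, x t = y t - c • ∫ s in (0 : ℝ)..t, (x s.toNNReal - proj D (x s.toNNReal))

/-- `(x, k)` solves the Skorokhod problem on `D` associated with `y`. The measure `μ = d|k|` is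
the (unique) one with `μ [0, t] = |k|_t` for all `t`, where `|k|_t` is the total variation of `k`
on `[0, t]` with respect to the Euclidean norm. -/
structure IsSkorokhodSolution (D : Set (EuclideanSpace ℝ (Fin d)))
    (y x k : Cadlag (EuclideanSpace ℝ (Fin d))) : Prop where
  eq_add : ∀ t, x t = y t + k t
  mem_closure : ∀ t, x t ∈ closure D
  zero : k 0 = 0
  locallyBoundedVariation : LocallyBoundedVariationOn k univ
  reflection : ∃ μ : Measure ℝ≥0, (∀ t, μ (Iic t) = eVariationOn k (Iic t)) ∧
    (∃ n : ℝ≥0 → EuclideanSpace ℝ (Fin d), AEStronglyMeasurable n μ ∧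
      (∀ s, x s ∈ frontier D → n s ∈ inwardNormals D (x s)) ∧
      ∀ t, k t = ∫ s in Iic t, n s ∂μ) ∧
    ∀ t, eVariationOn k (Iic t) = μ (Iic t ∩ {s | x s ∈ frontier D})

end Equations

/-!
# Penalization of the Skorokhod problem on a convex domain: convergence in law

The topology `J₁` is induced by a uniformity with a countable basis, hence pseudo-metrizable, and its
Borel `σ`-algebra is generated by the evaluations. The portmanteau theorem therefore applies, in the
form of an extended continuous mapping theorem (`TendstoInDistribution.of_relation`), and both parts
reduce to statements about single paths that hold uniformly on `J₁`-neighbourhoods of the data.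

For a single path, let `β = x - Π(x)` and let `a` be the centre of a ball of radius `ρ` inside `D`.
Then `⟨x - a, β⟩ ≥ ρ |β|`, so on any interval on which `y` moves by at most `ρ / 2` the variation
`c ∫ |β|` of the penalization term is at most `|x - a|² / ρ`, with `x` taken at the left end. A
càdlàg `y` has only finitely many such pieces on `[0, T]`, and their number is stable under
`J₁`-perturbation, which bounds paths and variations uniformly in the parameter `c` and locally
uniformly in `y` (`exists_uniform_bound`). Next, since `x ↦ x - Π(x)` is monotone, on an interval
`[s, v)` on which `y` moves by at most `η` the path stays within `O(√η)` of the relaxation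
`Π(x_s) + e^{-c (u - s)} (x_s - Π(x_s))` (`PenalizedEq.norm_sub_relaxation_le`). Hence on each piece
of a partition of `y` the projection `Π(x)` is nearly constant, and `x` itself is nearly constant
after a relaxation layer whose length tends to `0` as `c → ∞`.

Part (i) follows: if `s < u < t` are close together and `z` moves between `u` and `t`, then a common
partition point of `y` and `z` lies in `(u, t]`, so `s` and `u` belong to the settled part of the
preceding piece (`exists_jakubowskiModulus_le`). Tightness provides the compact set on which this is
uniform.

For part (ii), let `(x, k)` solve the Skorokhod problem for `y`, with `k = ∫ n dμ`, and let `x'` be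
a penalized path for some `y'` close to `y`. The squared distance `|k' - k|²` of the reflection terms
is followed from one partition point to the next, just before the jumps. There `k' - k` is nearly
`Π(x') - x`, and the increments of `k'` and `-k` have almost nonpositive inner product with
`Π(x') - x`, because both penalization and reflection push along inward normals
(`norm_sq_le_of_increment`). The errors are proportional to the variations, so they sum up to a small
total regardless of the number of pieces (`exists_proj_mem_skorokhodNhd`). The projection is essential
here, since `x'` itself differs from `x` in the relaxation layers; where `y` has no jump there is no
such layer, and `x'` converges too (`exists_dist_eval_le`).
-/

/-! ### The Skorokhod topology is pseudo-metrizable -/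

namespace Cadlag

section Topology

variable {E : Type*} [PseudoMetricSpace E]

theorem skorokhodNhd_mono (x : Cadlag E) {N M : ℝ≥0} {ε η : ℝ} (hN : N ≤ M) (hε : η ≤ ε) :
    skorokhodNhd x M η ⊆ skorokhodNhd x N ε := by
  rintro y ⟨lam, h1, h2⟩
  exact ⟨lam, fun s => (h1 s).trans hε, fun s hs => (h2 s (hs.trans hN)).trans hε⟩

theorem self_mem_skorokhodNhd (x : Cadlag E) (N : ℝ≥0) {ε : ℝ} (hε : 0 ≤ ε) :
    x ∈ skorokhodNhd x N ε :=
  ⟨OrderIso.refl _, fun s => by simpa using hε, fun s _ => by simpa using hε⟩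

theorem skorokhodNhd_symm {x y : Cadlag E} {N : ℝ≥0} {ε : ℝ} (hε : ε ≤ 1)
    (h : y ∈ skorokhodNhd x (N + 1) ε) : x ∈ skorokhodNhd y N ε := by
  obtain ⟨lam, h1, h2⟩ := h
  have h3 : ∀ s, dist (lam.symm s) s ≤ ε := fun s => by
    have := h1 (lam.symm s)
    rwa [lam.apply_symm_apply, dist_comm] at this
  refine ⟨lam.symm, h3, fun s hs => ?_⟩
  have h4 : lam.symm s ≤ N + 1 := by
    have h5 := (abs_le.1 ((NNReal.dist_eq _ _).symm.le.trans (h3 s))).2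
    have h6 : (s : ℝ) ≤ N := hs
    have : (lam.symm s : ℝ) ≤ N + 1 := by linarith
    exact_mod_cast this
  have := h2 _ h4
  rwa [lam.apply_symm_apply, dist_comm] at this

theorem skorokhodNhd_trans {x y z : Cadlag E} {N M : ℝ≥0} {ε η : ℝ}
    (h : y ∈ skorokhodNhd x N ε) (hM : (N : ℝ) + ε ≤ M) (h' : z ∈ skorokhodNhd y M η) :
    z ∈ skorokhodNhd x N (ε + η) := by
  obtain ⟨lam, h1, h2⟩ := h
  obtain ⟨mu, h3, h4⟩ := h'
  refine ⟨lam.trans mu, fun s => ?_, fun s hs => ?_⟩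
  · have := dist_triangle (mu (lam s)) (lam s) s
    have := h1 s
    have := h3 (lam s)
    change dist (mu (lam s)) s ≤ _
    linarith
  · have hs' : lam s ≤ M := by
      have h5 := (abs_le.1 ((NNReal.dist_eq _ _).symm.le.trans (h1 s))).2
      have h6 : (s : ℝ) ≤ N := hs
      have : (lam s : ℝ) ≤ M := by linarith
      exact_mod_cast this
    have := dist_triangle (z (mu (lam s))) (y (lam s)) (x s)
    have := h2 s hs
    have := h4 _ hs'
    change dist (z (mu (lam s))) (x s) ≤ _
    linarith

theorem mem_nhds_iff_skorokhodNhd {x : Cadlag E} {S : Set (Cadlag E)} :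
    S ∈ 𝓝 x ↔ ∃ N : ℝ≥0, ∃ ε : ℝ, 0 < ε ∧ skorokhodNhd x N ε ⊆ S := by
  constructor
  · intro h
    obtain ⟨U, hU, ho, hx⟩ := mem_nhds_iff.1 h
    obtain ⟨N, ε, hε, h⟩ := ho x hx
    exact ⟨N, ε, hε, h.trans hU⟩
  · rintro ⟨N, ε, hε, h⟩
    refine mem_nhds_iff.2 ⟨{y | ∃ ε' < ε, y ∈ skorokhodNhd x N ε'}, ?_, ?_,
      ⟨0, hε, self_mem_skorokhodNhd x N le_rfl⟩⟩
    · rintro y ⟨ε', h1, h2⟩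
      exact h (skorokhodNhd_mono x le_rfl h1.le h2)
    · rintro y ⟨ε', h1, h2⟩
      refine ⟨N + ε'.toNNReal, (ε - ε') / 2, by linarith, fun z hz => ?_⟩
      refine ⟨ε' + (ε - ε') / 2, by linarith, skorokhodNhd_trans h2 ?_ hz⟩
      push_cast
      have := Real.le_coe_toNNReal ε'
      linarith

theorem skorokhodNhd_mem_nhds (x : Cadlag E) (N : ℝ≥0) {ε : ℝ} (hε : 0 < ε) :
    skorokhodNhd x N ε ∈ 𝓝 x :=
  mem_nhds_iff_skorokhodNhd.2 ⟨N, ε, hε, subset_rfl⟩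

/-- The entourages `{(x, y) | y ∈ skorokhodNhd x n (1 / (n + 1))}` of the `J₁` uniformity. -/
def entourage (E : Type*) [PseudoMetricSpace E] (n : ℕ) : Set (Cadlag E × Cadlag E) :=
  {p | p.2 ∈ skorokhodNhd p.1 (n : ℝ≥0) (1 / ((n : ℝ) + 1))}

theorem entourage_antitone : Antitone (entourage E) := by
  rintro n m hnm ⟨x, y⟩ h
  refine skorokhodNhd_mono x ?_ ?_ h
  · exact_mod_cast hnm
  · exact Nat.one_div_le_one_div hnm

theorem entourage_hasBasis :
    (⨅ n, 𝓟 (entourage E n)).HasBasis (fun _ => True) (entourage E) :=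
  hasBasis_iInf_principal entourage_antitone.directed_ge

/-- A uniform structure with a countable basis that induces the topology `J₁`. -/
abbrev uniformSpace (E : Type*) [PseudoMetricSpace E] : UniformSpace (Cadlag E) where
  toTopologicalSpace := inferInstance
  uniformity := ⨅ n, 𝓟 (entourage E n)
  symm := by
    refine (entourage_hasBasis.tendsto_iff entourage_hasBasis).2 fun n _ => ⟨n + 1, trivial, ?_⟩
    rintro ⟨x, y⟩ h
    refine skorokhodNhd_symm ?_ (skorokhodNhd_mono x (by push_cast; rfl)
      (Nat.one_div_le_one_div n.le_succ) h)
    rw [div_le_one (by positivity)]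
    linarith [n.cast_nonneg (α := ℝ)]
  comp := by
    refine (entourage_hasBasis.lift' (monotone_id.relComp monotone_id)).le_basis_iff
      entourage_hasBasis |>.2 fun n _ => ⟨2 * n + 1, trivial, ?_⟩
    rintro ⟨x, z⟩ ⟨y, h1, h2⟩
    have e : 1 / (((2 * n + 1 : ℕ) : ℝ) + 1) + 1 / (((2 * n + 1 : ℕ) : ℝ) + 1)
        = 1 / ((n : ℝ) + 1) := by
      push_cast
      field_simp
      ring
    have h1' := skorokhodNhd_mono x (N := n) (by exact_mod_cast (by omega : n ≤ 2 * n + 1))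
      le_rfl h1
    have := skorokhodNhd_trans h1' ?_ h2
    · rw [e] at this
      exact this
    · push_cast
      have : 1 / (2 * (n : ℝ) + 1 + 1) ≤ 1 := by
        rw [div_le_one (by positivity)]
        linarith [n.cast_nonneg (α := ℝ)]
      linarith [n.cast_nonneg (α := ℝ)]
  nhds_eq_comap_uniformity x := by
    ext S
    rw [(entourage_hasBasis.comap _).mem_iff, mem_nhds_iff_skorokhodNhd]
    constructor
    · rintro ⟨N, ε, hε, h⟩
      obtain ⟨n, hn⟩ := exists_nat_ge (max (N : ℝ) (1 / ε))
      refine ⟨n, trivial, fun y hy => h (skorokhodNhd_mono x ?_ ?_ hy)⟩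
      · exact_mod_cast (le_max_left _ _).trans hn
      · rw [div_le_iff₀ (by positivity)]
        have h1 := (le_max_right _ _).trans hn
        rw [div_le_iff₀ hε] at h1
        linarith
    · rintro ⟨n, -, h⟩
      exact ⟨n, 1 / ((n : ℝ) + 1), by positivity, fun y hy => h hy⟩

instance : TopologicalSpace.PseudoMetrizableSpace (Cadlag E) := by
  let := uniformSpace E
  have : (uniformity (Cadlag E)).IsCountablyGenerated :=
    entourage_hasBasis.isCountablyGenerated
  exact UniformSpace.pseudoMetrizableSpace

end Topology

end Cadlag

/-! ### Càdlàg functions -/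

namespace Cadlag

variable {E : Type*} [PseudoMetricSpace E]

/-- The points `0 = t 0 < ⋯ < t r` cut `[0, t r)` into half-open pieces on each of which `x` stays
within `η` of its value at the left endpoint. -/
structure IsPartition (x : Cadlag E) (η : ℝ) (r : ℕ) (t : ℕ → ℝ≥0) : Prop where
  zero : t 0 = 0
  lt_succ : ∀ i < r, t i < t (i + 1)
  dist_le : ∀ i < r, ∀ u, t i ≤ u → u < t (i + 1) → dist (x u) (x (t i)) ≤ η

namespace IsPartition

theorem extend {x : Cadlag E} {η : ℝ} {r : ℕ} {t : ℕ → ℝ≥0} (h : IsPartition x η r t) {T : ℝ≥0}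
    (hT : t r < T) (hx : ∀ u, t r ≤ u → u < T → dist (x u) (x (t r)) ≤ η) :
    IsPartition x η (r + 1) (Function.update t (r + 1) T) := by
  have e : ∀ i ≤ r, Function.update t (r + 1) T i = t i := fun i hi =>
    Function.update_of_ne (by omega) _ _
  refine ⟨by rw [e 0 (by omega), h.zero], fun i hi => ?_, fun i hi u h1 h2 => ?_⟩
  · rcases eq_or_lt_of_le (Nat.lt_succ_iff.1 hi) with rfl | hi'
    · rw [e _ le_rfl, Function.update_self]
      exact hT
    · rw [e _ hi'.le, e _ hi']
      exact h.lt_succ i hi'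
  · rcases eq_or_lt_of_le (Nat.lt_succ_iff.1 hi) with rfl | hi'
    · rw [e _ le_rfl] at h1 ⊢
      rw [Function.update_self] at h2
      exact hx u h1 h2
    · rw [e _ hi'.le] at h1 ⊢
      rw [e _ hi'] at h2
      exact h.dist_le i hi' u h1 h2

theorem monotone {x : Cadlag E} {η : ℝ} {r : ℕ} {t : ℕ → ℝ≥0} (h : IsPartition x η r t)
    {i j : ℕ} (hij : i ≤ j) (hj : j ≤ r) : t i ≤ t j := by
  induction j, hij using Nat.le_induction with
  | base => exact le_rfl
  | succ j _ ih => exact (ih (by omega)).trans (h.lt_succ j (by omega)).le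

/-- Every time before the last point lies in one of the pieces. -/
theorem exists_mem {x : Cadlag E} {η : ℝ} {r : ℕ} {t : ℕ → ℝ≥0} (h : IsPartition x η r t)
    {u : ℝ≥0} (hu : u < t r) : ∃ i < r, t i ≤ u ∧ u < t (i + 1) := by
  have hex : ∃ j, u < t j := ⟨r, hu⟩
  classical
  have h0 : Nat.find hex ≠ 0 := fun h0 => by
    have := Nat.find_spec hex
    rw [h0, h.zero] at this
    exact not_lt_zero this
  obtain ⟨i, hi⟩ := Nat.exists_eq_succ_of_ne_zero h0
  have h1 := Nat.find_le (h := hex) hu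
  refine ⟨i, by omega, not_lt.1 (Nat.find_min hex (m := i) (by omega)), ?_⟩
  have := Nat.find_spec hex
  rwa [hi] at this

end IsPartition

/-- A càdlàg function has partitions of arbitrarily small oscillation on every `[0, T]`. -/
theorem exists_isPartition (x : Cadlag E) {η : ℝ} (hη : 0 < η) (T : ℝ≥0) :
    ∃ r t, IsPartition x η r t ∧ t r = T := by
  let S : Set ℝ≥0 := {T | ∃ r t, IsPartition x η r t ∧ t r = T}
  have h0 : (0 : ℝ≥0) ∈ S :=
    ⟨0, fun _ => 0, ⟨rfl, fun i hi => absurd hi (by omega), fun i hi => absurd hi (by omega)⟩, rfl⟩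
  -- a point that can be reached and a later point with no large oscillation in between
  have hext : ∀ a ∈ S, ∀ b, a < b → (∀ u, a ≤ u → u < b → dist (x u) (x a) ≤ η) → b ∈ S := by
    rintro a ⟨r, t, h, rfl⟩ b hab hb
    exact ⟨r + 1, _, h.extend hab hb, Function.update_self _ _ _⟩
  have hright : ∀ a ∈ S, ∃ b, a < b ∧ ∀ c, a < c → c ≤ b → c ∈ S := by
    intro a ha
    have h1 : ∀ᶠ u in 𝓝[≥] a, dist (x u) (x a) < η :=
      (tendsto_iff_dist_tendsto_zero.1 (x.right_continuous a)).eventually_lt_const hη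
    obtain ⟨b, hb, h2⟩ := (mem_nhdsGE_iff_exists_Ico_subset' (show a < a + 1 by simp)).1 h1
    exact ⟨b, hb, fun c hc hcb => hext a ha c hc fun u hu hu' =>
      (h2 ⟨hu, hu'.trans_le hcb⟩).le⟩
  have hleft : ∀ b, 0 < b → ∃ a < b, ∀ c ∈ S, a < c → c < b → b ∈ S := by
    intro b hb
    obtain ⟨l, hl⟩ := x.left_limits b
    have h1 : ∀ᶠ u in 𝓝[<] b, dist (x u) l < η / 2 :=
      (tendsto_iff_dist_tendsto_zero.1 hl).eventually_lt_const (by positivity)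
    obtain ⟨a, ha, h2⟩ := (mem_nhdsLT_iff_exists_Ioo_subset' hb).1 h1
    refine ⟨a, ha, fun c hc hac hcb => hext c hc b hcb fun u hu hub => ?_⟩
    have h3 : dist (x u) l < η / 2 := h2 ⟨hac.trans_le hu, hub⟩
    have h4 : dist (x c) l < η / 2 := h2 ⟨hac, hcb⟩
    have := dist_triangle_right (x u) (x c) l
    linarith
  by_contra hT
  let A : Set ℝ≥0 := {a | a ≤ T ∧ Icc 0 a ⊆ S}
  have hA0 : (0 : ℝ≥0) ∈ A := ⟨zero_le, fun u hu => by
    rw [le_antisymm hu.2 hu.1]; exact h0⟩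
  have hAb : BddAbove A := ⟨T, fun a ha => ha.1⟩
  set b := sSup A
  have hbT : b ≤ T := csSup_le ⟨0, hA0⟩ fun a ha => ha.1
  have hlt : ∀ u < b, u ∈ S := fun u hu => by
    obtain ⟨a, ha, hua⟩ := exists_lt_of_lt_csSup ⟨0, hA0⟩ hu
    exact ha.2 ⟨zero_le, hua.le⟩
  have hbS : b ∈ S := by
    rcases eq_or_lt_of_le (zero_le (a := b)) with hb | hb
    · rw [← hb]; exact h0
    · obtain ⟨a, ha, h⟩ := hleft b hb
      obtain ⟨c, hac, hcb⟩ := exists_between ha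
      exact h c (hlt c hcb) hac hcb
  have hbT' : b < T := lt_of_le_of_ne hbT fun e => hT (e ▸ hbS)
  obtain ⟨c, hbc, hc⟩ := hright b hbS
  have hm : min c T ∈ A := ⟨min_le_right _ _, fun u hu => by
    rcases lt_trichotomy u b with h | h | h
    · exact hlt u h
    · rw [h]; exact hbS
    · exact hc u h (hu.2.trans (min_le_left _ _))⟩
  exact absurd (le_csSup hAb hm) (not_le.2 (lt_min hbc hbT'))

end Cadlag

/-! ### The Borel `σ`-algebra of `J₁` is generated by the evaluations -/

namespace Cadlag

section Measurability

variable {E : Type*} [PseudoMetricSpace E]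

theorem isOpen_setOf_exists_mem (a b : ℝ≥0) {U : Set E} (hU : IsOpen U) :
    IsOpen {x : Cadlag E | ∃ s, a < s ∧ s < b ∧ x s ∈ U} := by
  rw [isOpen_iff_mem_nhds]
  rintro x ⟨s, has, hsb, hs⟩
  obtain ⟨ε, hε, hball⟩ := Metric.isOpen_iff.1 hU _ hs
  have h1 : (a : ℝ) < s := has
  have h2 : (s : ℝ) < b := hsb
  set η := min (ε / 2) (min ((s - a : ℝ) / 2) ((b - s : ℝ) / 2))
  have hη1 : η ≤ ε / 2 := min_le_left _ _
  have hη2 : η ≤ (s - a : ℝ) / 2 := (min_le_right _ _).trans (min_le_left _ _)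
  have hη3 : η ≤ (b - s : ℝ) / 2 := (min_le_right _ _).trans (min_le_right _ _)
  have hη : 0 < η := lt_min (by linarith) (lt_min (by linarith) (by linarith))
  filter_upwards [skorokhodNhd_mem_nhds x s hη]
  rintro y ⟨lam, h3, h4⟩
  have h5 := abs_le.1 ((NNReal.dist_eq _ _).symm.le.trans (h3 s))
  refine ⟨lam s, ?_, ?_, hball ?_⟩
  · have : (a : ℝ) < lam s := by linarith
    exact_mod_cast this
  · have : (lam s : ℝ) < b := by linarith
    exact_mod_cast this
  · rw [Metric.mem_ball]
    linarith [h4 s le_rfl]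

theorem measurable_eval [MeasurableSpace E] [BorelSpace E] (t : ℝ≥0) :
    Measurable fun x : Cadlag E => x t := by
  refine measurable_of_isClosed fun F hF => ?_
  have hset : (fun x : Cadlag E => x t) ⁻¹' F = ⋂ j : ℕ, {x : Cadlag E |
      ∃ s, t < s ∧ s < t + 1 / ((j : ℝ≥0) + 1) ∧ x s ∈ Metric.thickening (1 / ((j : ℝ) + 1)) F} := by
    ext x
    simp only [mem_preimage, mem_iInter, mem_ofPred_eq]
    constructor
    · intro hx j
      have hpos : (0 : ℝ) < 1 / ((j : ℝ) + 1) := by positivity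
      have h1 : ∀ᶠ s in 𝓝[>] t, x s ∈ Metric.thickening (1 / ((j : ℝ) + 1)) F :=
        ((x.right_continuous t).mono Ioi_subset_Ici_self)
          (Metric.isOpen_thickening.mem_nhds (Metric.self_subset_thickening hpos F hx))
      have h2 : ∀ᶠ s in 𝓝[>] t, s < t + 1 / ((j : ℝ≥0) + 1) :=
        (gt_mem_nhds (lt_add_of_pos_right t (by positivity))).filter_mono nhdsWithin_le_nhds
      obtain ⟨s, ⟨h3, h4⟩, h5⟩ := ((h1.and h2).and self_mem_nhdsWithin).exists
      exact ⟨s, h5, h4, h3⟩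
    · intro h
      choose s h1 h2 h3 using h
      have hlim0 : Tendsto (fun j : ℕ => t + 1 / ((j : ℝ≥0) + 1)) atTop (𝓝 t) := by
        have : Tendsto (fun j : ℕ => 1 / ((j : ℝ≥0) + 1)) atTop (𝓝 0) :=
          tendsto_one_div_add_atTop_nhds_zero_nat
        simpa using this.const_add t
      have hlim : Tendsto s atTop (𝓝[≥] t) :=
        tendsto_nhdsWithin_iff.2 ⟨tendsto_of_tendsto_of_tendsto_of_le_of_le tendsto_const_nhds
          hlim0 (fun j => (h1 j).le) (fun j => (h2 j).le), Eventually.of_forall fun j => (h1 j).le⟩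
      have hx := (x.right_continuous t).tendsto.comp hlim
      rw [← hF.closure_eq, Metric.mem_closure_iff]
      intro ε hε
      have h5 := (tendsto_iff_dist_tendsto_zero.1 hx).eventually_lt_const (half_pos hε)
      have h6 := tendsto_one_div_add_atTop_nhds_zero_nat.eventually_lt_const (half_pos hε)
      obtain ⟨j, h7, h8⟩ := (h5.and h6).exists
      obtain ⟨z, hz, hz'⟩ := Metric.mem_thickening_iff.1 (h3 j)
      refine ⟨z, hz, ?_⟩
      have := dist_triangle_left (x t) z (x (s j))
      simp only [Function.comp] at h7
      linarith
  rw [hset]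
  exact MeasurableSet.iInter fun j =>
    (isOpen_setOf_exists_mem _ _ Metric.isOpen_thickening).measurableSet

/-- The càdlàg step function with value `a i` on `[i / K, (i + 1) / K)`. -/
noncomputable def step (K : ℕ) (a : ℕ → E) : Cadlag E where
  toFun t := a ⌊(K : ℝ≥0) * t⌋₊
  right_continuous t := by
    have h : ∀ᶠ u in 𝓝[≥] t, (K : ℝ≥0) * u < ⌊(K : ℝ≥0) * t⌋₊ + 1 :=
      ((continuous_const.mul continuous_id).continuousAt.eventually_lt_const
        (Nat.lt_floor_add_one ((K : ℝ≥0) * t))).filter_mono nhdsWithin_le_nhds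
    refine tendsto_nhds_of_eventually_eq ?_
    filter_upwards [h, self_mem_nhdsWithin] with u hu htu
    congr 1
    rw [Nat.floor_eq_iff zero_le]
    exact ⟨(Nat.floor_le zero_le).trans (mul_le_mul_right htu _), hu⟩
  left_limits t := by
    rcases eq_or_lt_of_le (zero_le (a := (K : ℝ≥0) * t)) with h0 | h0
    · refine ⟨a 0, tendsto_nhds_of_eventually_eq ?_⟩
      filter_upwards [self_mem_nhdsWithin] with u hu
      have : (K : ℝ≥0) * u = 0 := le_antisymm (h0 ▸ mul_le_mul_right (le_of_lt hu) _) zero_le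
      rw [this, Nat.floor_zero]
    · obtain ⟨m, hm⟩ := Nat.exists_eq_succ_of_ne_zero (Nat.ceil_pos.2 h0).ne'
      have h1 : (m : ℝ≥0) < K * t := Nat.lt_ceil.1 (by omega)
      have h2 : (K : ℝ≥0) * t ≤ m + 1 := by
        have := Nat.le_ceil ((K : ℝ≥0) * t)
        rw [hm] at this
        exact_mod_cast this
      have h : ∀ᶠ u in 𝓝[<] t, (m : ℝ≥0) < K * u :=
        ((continuous_const.mul continuous_id).continuousAt.eventually_const_lt
          h1).filter_mono nhdsWithin_le_nhds
      refine ⟨a m, tendsto_nhds_of_eventually_eq ?_⟩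
      filter_upwards [h, self_mem_nhdsWithin] with u hu hut
      congr 1
      rw [Nat.floor_eq_iff zero_le]
      refine ⟨hu.le, lt_of_lt_of_le ?_ h2⟩
      exact mul_lt_mul_of_pos_left hut (pos_of_mul_pos_left h0 zero_le)

theorem continuous_step (K : ℕ) : Continuous (step K : (ℕ → E) → Cadlag E) := by
  refine continuous_iff_continuousAt.2 fun a S hS => ?_
  obtain ⟨N, ε, hε, h⟩ := mem_nhds_iff_skorokhodNhd.1 hS
  have h1 : ∀ᶠ b in 𝓝 a, ∀ i ∈ Finset.range (⌊(K : ℝ≥0) * N⌋₊ + 1), dist (b i) (a i) < ε := by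
    rw [Filter.eventually_all_finset]
    exact fun i _ => (tendsto_iff_dist_tendsto_zero.1
      ((continuous_apply i).tendsto a)).eventually_lt_const hε
  refine mem_map.2 (h1.mono fun b hb => h ⟨OrderIso.refl _, fun s => by simpa using hε.le,
    fun s hs => (hb _ ?_).le⟩)
  exact Finset.mem_range.2 (Nat.lt_succ_of_le (Nat.floor_mono (mul_le_mul_right hs _)))

/-- A small time change that moves every point of a well separated set `T` to the next multiple
of `1 / K`. -/
theorem exists_orderIso_ceil {K : ℕ} (hK : 0 < K) {T : Set ℝ≥0} (h0 : 0 ∈ T)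
    (hT : ∀ s ∈ T, ∀ t ∈ T, s ≠ t → 2 / (K : ℝ) ≤ dist s t) :
    ∃ lam : ℝ≥0 ≃o ℝ≥0, (∀ t ∈ T, lam t = ⌈(K : ℝ≥0) * t⌉₊ / K) ∧
      ∀ t, dist (lam t) t ≤ 1 / K := by
  have hK' : (0 : ℝ) < K := by exact_mod_cast hK
  have hK'' : (0 : ℝ≥0) < K := by exact_mod_cast hK
  set f : ℝ≥0 → ℝ := fun t => (⌈(K : ℝ≥0) * t⌉₊ : ℝ) / K - t with hf
  have hf0 : ∀ t, 0 ≤ f t := fun t => by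
    have h : (K : ℝ≥0) * t ≤ ⌈(K : ℝ≥0) * t⌉₊ := Nat.le_ceil _
    have h' : (K : ℝ) * t ≤ ⌈(K : ℝ≥0) * t⌉₊ := by exact_mod_cast h
    rw [hf, sub_nonneg, le_div_iff₀ hK']
    linarith
  have hf1 : ∀ t, f t ≤ 1 / K := fun t => by
    have h : (⌈(K : ℝ≥0) * t⌉₊ : ℝ≥0) < K * t + 1 := Nat.ceil_lt_add_one zero_le
    have h' : (⌈(K : ℝ≥0) * t⌉₊ : ℝ) < K * t + 1 := by exact_mod_cast h
    rw [hf, sub_le_iff_le_add, div_le_iff₀ hK', add_mul, div_mul_cancel₀ _ hK'.ne']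
    linarith
  have hLip : LipschitzOnWith (1 / 2) f T := by
    refine LipschitzOnWith.of_dist_le_mul fun s hs t ht => ?_
    rcases eq_or_ne s t with rfl | hst
    · simp
    · have h := hT s hs t ht hst
      have : dist (f s) (f t) ≤ 1 / K := by
        rw [Real.dist_eq, abs_le]
        constructor <;> linarith [hf0 s, hf0 t, hf1 s, hf1 t]
      refine this.trans ?_
      have e : 1 / (K : ℝ) = 1 / 2 * (2 / K) := by ring
      rw [e]
      push_cast
      exact mul_le_mul_of_nonneg_left h (by norm_num)
  obtain ⟨g, hg, hgf⟩ := hLip.extend_real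
  -- the Lipschitz extension of the displacement, cut off to `[0, 1 / K]`
  set φ : ℝ≥0 → ℝ := fun t => max 0 (min (g t) (1 / K)) with hφ
  have hφ0 : ∀ t, 0 ≤ φ t := fun t => le_max_left _ _
  have hφ1 : ∀ t, φ t ≤ 1 / K := fun t => max_le (by positivity) (min_le_right _ _)
  have hφL : ∀ s t, |φ s - φ t| ≤ 1 / 2 * dist s t := fun s t => by
    have h1 := hg.dist_le_mul s t
    rw [Real.dist_eq] at h1
    refine le_trans ?_ (h1.trans (by simp))
    refine (abs_max_sub_max_le_max _ _ _ _).trans ?_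
    refine max_le (by simp) ((abs_min_sub_min_le_max _ _ _ _).trans (max_le le_rfl (by simp)))
  have hφT : ∀ t ∈ T, φ t = f t := fun t ht => by
    simp only [hφ]
    rw [← hgf ht, min_eq_left (hf1 t), max_eq_right (hf0 t)]
  set F : ℝ≥0 → ℝ≥0 := fun t => t + (φ t).toNNReal with hF
  have hFc : ∀ t, (F t : ℝ) = t + φ t := fun t => by
    simp only [hF, NNReal.coe_add, Real.coe_toNNReal _ (hφ0 t)]
  have hmono : StrictMono F := fun s t hst => by
    have h1 := hφL s t
    have h2 : (s : ℝ) < t := hst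
    rw [NNReal.dist_eq, abs_of_neg (a := (s : ℝ) - t) (by linarith)] at h1
    have h3 := (abs_le.1 h1).2
    have : (F s : ℝ) < F t := by rw [hFc, hFc]; linarith
    exact_mod_cast this
  have hφc : Continuous φ := by
    have := hg.continuous
    fun_prop
  have hcont : Continuous F := by fun_prop
  have hF0 : F 0 = 0 := by
    have h1 : f 0 = 0 := by simp [hf]
    apply NNReal.coe_injective
    rw [hFc, hφT 0 h0, h1]
    simp
  have hsurj : Function.Surjective F := fun v => by
    have h1 := intermediate_value_Icc (zero_le (a := v)) hcont.continuousOn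
    obtain ⟨u, -, hu⟩ := h1 (show v ∈ Icc (F 0) (F v) from
      ⟨by rw [hF0]; exact zero_le, le_self_add⟩)
    exact ⟨u, hu⟩
  refine ⟨hmono.orderIsoOfSurjective F hsurj, fun t ht => ?_, fun t => ?_⟩
  · apply NNReal.coe_injective
    change (F t : ℝ) = _
    rw [hFc, hφT t ht]
    simp [hf]
  · change dist (F t) t ≤ _
    rw [NNReal.dist_eq, hFc, add_sub_cancel_left, abs_of_nonneg (hφ0 t)]
    exact hφ1 t

theorem IsPartition.exists_gap {x : Cadlag E} {η : ℝ} {r : ℕ} {t : ℕ → ℝ≥0}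
    (h : IsPartition x η r t) : ∃ γ : ℝ, 0 < γ ∧ ∀ i < r, (t i : ℝ) + γ ≤ t (i + 1) := by
  obtain ⟨γ, hγ, h'⟩ : ∃ γ : ℝ, 0 < γ ∧ ∀ i ∈ Finset.range r, γ < t (i + 1) - (t i : ℝ) := by
    refine (((Filter.eventually_all_finset (l := 𝓝[>] (0 : ℝ)) (Finset.range r)).2
      fun i hi => ?_).and self_mem_nhdsWithin).exists.imp fun γ h => ⟨h.2, h.1⟩
    have : (t i : ℝ) < t (i + 1) := h.lt_succ i (Finset.mem_range.1 hi)
    exact (gt_mem_nhds (sub_pos.2 this)).filter_mono nhdsWithin_le_nhds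
  exact ⟨γ, hγ, fun i hi => by linarith [h' i (Finset.mem_range.2 hi)]⟩

/-- The values of `x` on the grid `{i / K}` give step functions that converge to `x` in `J₁`. -/
theorem tendsto_step (x : Cadlag E) :
    Tendsto (fun k : ℕ => step (k + 1) fun i => x ((i : ℝ≥0) / (k + 1 : ℕ))) atTop (𝓝 x) := by
  intro S hS
  obtain ⟨N, ε, hε, hS⟩ := mem_nhds_iff_skorokhodNhd.1 hS
  obtain ⟨r, t, ht, htr⟩ := x.exists_isPartition (half_pos hε) (N + 1)
  obtain ⟨γ, hγ, hgap⟩ := ht.exists_gap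
  have hgap' : ∀ i j, i < j → j ≤ r → γ ≤ (t j : ℝ) - t i := fun i j hij hj => by
    have h1 := hgap i (by omega)
    have h2 : (t (i + 1) : ℝ) ≤ t j := ht.monotone hij hj
    linarith
  have hlim := tendsto_one_div_add_atTop_nhds_zero_nat (𝕜 := ℝ)
  have h1 := hlim.eventually_lt_const (half_pos hγ)
  have h2 := hlim.eventually_lt_const hε
  refine mem_map.2 ?_
  filter_upwards [h1, h2] with k hk1 hk2
  apply hS
  have hK : ((k + 1 : ℕ) : ℝ) = (k : ℝ) + 1 := by push_cast; ring
  have hKpos : (0 : ℝ≥0) < (k + 1 : ℕ) := by positivity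
  obtain ⟨lam, h3, h4⟩ := exists_orderIso_ceil (K := k + 1) (T := t '' Iic r) k.succ_pos
    ⟨0, Nat.zero_le r, ht.zero⟩ (by
      rintro _ ⟨i, hi, rfl⟩ _ ⟨j, hj, rfl⟩ hij
      have hk : 2 / ((k + 1 : ℕ) : ℝ) ≤ γ := by
        rw [hK]
        have : 2 / ((k : ℝ) + 1) = 2 * (1 / ((k : ℝ) + 1)) := by ring
        linarith
      rw [NNReal.dist_eq]
      rcases lt_or_gt_of_ne (fun h => hij (congrArg t h) : i ≠ j) with h | h
      · have := hgap' i j h hj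
        rw [abs_sub_comm]
        exact hk.trans (this.trans (le_abs_self _))
      · have := hgap' j i h hi
        exact hk.trans (this.trans (le_abs_self _)))
  refine ⟨lam, fun s => (h4 s).trans (by rw [hK]; exact hk2.le), fun u hu => ?_⟩
  obtain ⟨i, hi, hi1, hi2⟩ := ht.exists_mem (u := u) (by rw [htr]; exact lt_of_le_of_lt hu (by simp))
  have h5 := lam.monotone hi1
  have h6 := lam.strictMono hi2
  rw [h3 _ ⟨i, hi.le, rfl⟩, div_le_iff₀ hKpos, mul_comm (lam u)] at h5
  rw [h3 _ ⟨i + 1, hi, rfl⟩, lt_div_iff₀ hKpos, mul_comm (lam u)] at h6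
  set m := ⌊((k + 1 : ℕ) : ℝ≥0) * lam u⌋₊ with hm
  have h7 : t i ≤ (m : ℝ≥0) / (k + 1 : ℕ) := by
    rw [le_div_iff₀ hKpos, mul_comm]
    exact Nat.ceil_le.1 (Nat.le_floor h5)
  have h8 : (m : ℝ≥0) / (k + 1 : ℕ) < t (i + 1) := by
    rw [div_lt_iff₀ hKpos, mul_comm]
    exact Nat.lt_ceil.1 ((Nat.floor_lt zero_le).2 h6)
  have h9 := ht.dist_le i hi _ h7 h8
  have h10 := ht.dist_le i hi _ hi1 hi2
  have h11 := dist_triangle_right (x ((m : ℝ≥0) / (k + 1 : ℕ))) (x u) (x (t i))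
  change dist (x ((m : ℝ≥0) / (k + 1 : ℕ))) (x u) ≤ ε
  linarith

theorem measurable_of_eval [SecondCountableTopology E] [MeasurableSpace E] [BorelSpace E]
    {Ω : Type*} [MeasurableSpace Ω] {ξ : Ω → Cadlag E}
    (h : ∀ t, Measurable fun ω => ξ ω t) : Measurable ξ := by
  refine measurable_of_tendsto_metrizable
    (f := fun (k : ℕ) ω => step (k + 1) fun i => ξ ω ((i : ℝ≥0) / (k + 1 : ℕ))) (fun k => ?_)
    (tendsto_pi_nhds.2 fun ω => tendsto_step (ξ ω))
  exact (continuous_step (k + 1)).measurable.comp (measurable_pi_lambda _ fun i => h _)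

theorem measurable_toFun [MeasurableSpace E] [BorelSpace E] (x : Cadlag E) : Measurable x := by
  refine measurable_of_tendsto_metrizable
    (f := fun (k : ℕ) t => x (((⌊((k + 1 : ℕ) : ℝ≥0) * t⌋₊ + 1 : ℕ) : ℝ≥0) / (k + 1 : ℕ)))
    (fun k => ?_) (tendsto_pi_nhds.2 fun t => ?_)
  · have h1 : Measurable fun t : ℝ≥0 => ⌊((k + 1 : ℕ) : ℝ≥0) * t⌋₊ :=
      Nat.measurable_floor.comp (measurable_const_mul _)
    exact (measurable_from_nat (f := fun m => x (((m + 1 : ℕ) : ℝ≥0) / (k + 1 : ℕ)))).comp h1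
  · refine (x.right_continuous t).tendsto.comp (tendsto_nhdsWithin_iff.2
      ⟨?_, Eventually.of_forall fun k => ?_⟩)
    · have h0 : Tendsto (fun j : ℕ => t + 1 / ((j : ℝ≥0) + 1)) atTop (𝓝 t) := by
        have : Tendsto (fun j : ℕ => 1 / ((j : ℝ≥0) + 1)) atTop (𝓝 0) :=
          tendsto_one_div_add_atTop_nhds_zero_nat
        simpa using this.const_add t
      refine tendsto_of_tendsto_of_tendsto_of_le_of_le tendsto_const_nhds h0 (fun k => ?_)
        fun k => ?_
      · simp only
        rw [le_div_iff₀ (by positivity), mul_comm]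
        exact_mod_cast (Nat.lt_floor_add_one (((k + 1 : ℕ) : ℝ≥0) * t)).le
      · simp only
        have h1 : (⌊((k + 1 : ℕ) : ℝ≥0) * t⌋₊ : ℝ≥0) ≤ ((k + 1 : ℕ) : ℝ≥0) * t :=
          Nat.floor_le zero_le
        have e : t + 1 / ((k : ℝ≥0) + 1) = (((k + 1 : ℕ) : ℝ≥0) * t + 1) / (k + 1 : ℕ) := by
          push_cast
          field_simp
        rw [e]
        push_cast at h1 ⊢
        gcongr
    · simp only [mem_Ici]
      rw [le_div_iff₀ (by positivity), mul_comm]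
      exact_mod_cast (Nat.lt_floor_add_one (((k + 1 : ℕ) : ℝ≥0) * t)).le

end Measurability

end Cadlag

/-! ### Convergence in law -/

theorem convergesInLaw_iff {S : Type*} [TopologicalSpace S] [m : MeasurableSpace S] [BorelSpace S]
    {Ω : ℕ+ → Type*} {Ω' : Type*} [∀ n, MeasurableSpace (Ω n)] [MeasurableSpace Ω']
    {P : ∀ n, Measure (Ω n)} [∀ n, IsProbabilityMeasure (P n)]
    {P' : Measure Ω'} [IsProbabilityMeasure P'] {ξ : ∀ n, Ω n → S} {ζ : Ω' → S} :
    ConvergesInLaw P P' ξ ζ ↔ TendstoInDistribution ξ atTop ζ P P' := by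
  obtain rfl : m = borel S := BorelSpace.measurable_eq
  rfl

/-- An extended continuous mapping theorem: the `ζ n` are related to the `ξ n` by relations `R n`
that vary with `n`, and almost surely `R n` maps small neighbourhoods of the limit `ξ'` into small
neighbourhoods of `ζ'` as `n → ∞`. -/
theorem MeasureTheory.TendstoInDistribution.of_relation {S T ι : Type*} [TopologicalSpace S]
    [MeasurableSpace S] [BorelSpace S] [HasOuterApproxClosed S] [TopologicalSpace T]
    [MeasurableSpace T] [BorelSpace T] [Preorder ι] [IsDirectedOrder ι] [Nonempty ι]
    [Countable ι] [(atTop : Filter ι).IsCountablyGenerated]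
    {Ω : ι → Type*} {Ω' : Type*} [∀ n, MeasurableSpace (Ω n)] [MeasurableSpace Ω']
    {P : ∀ n, Measure (Ω n)} [∀ n, IsProbabilityMeasure (P n)]
    {P' : Measure Ω'} [IsProbabilityMeasure P'] {ξ : ∀ n, Ω n → S} {ξ' : Ω' → S}
    (h : TendstoInDistribution ξ atTop ξ' P P') {ζ : ∀ n, Ω n → T} {ζ' : Ω' → T}
    (hζ : ∀ n, AEMeasurable (ζ n) (P n)) (hζ' : AEMeasurable ζ' P') (R : ι → S → T → Prop)
    (hR : ∀ n, ∀ᵐ ω ∂(P n), R n (ξ n ω) (ζ n ω))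
    (hlim : ∀ᵐ ω ∂P', ∀ U ∈ 𝓝 (ζ' ω), ∃ V ∈ 𝓝 (ξ' ω), ∀ᶠ n in atTop, ∀ s ∈ V, ∀ t,
      R n s t → t ∈ U) :
    TendstoInDistribution ζ atTop ζ' P P' where
  forall_aemeasurable := hζ
  aemeasurable_limit := hζ'
  tendsto := by
    refine tendsto_of_forall_isClosed_limsup_le' fun F hF => ?_
    simp only [ProbabilityMeasure.coe_mk]
    -- `C k` collects all limits of points that some `R n`, `n ≥ k`, relates to a point of `F`
    let B : ι → Set S := fun k => {s | ∃ n, k ≤ n ∧ ∃ t ∈ F, R n s t}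
    let C : ι → Set S := fun k => closure (B k)
    have hC : Antitone C := fun k l hkl => closure_mono fun s ⟨n, hn, t, ht⟩ =>
      ⟨n, hkl.trans hn, t, ht⟩
    have hk : ∀ k, limsup (fun n => (P n).map (ζ n) F) atTop ≤ P'.map ξ' (C k) := fun k => by
      refine le_trans (limsup_le_limsup ?_)
        (ProbabilityMeasure.limsup_measure_closed_le_of_tendsto h.tendsto
          (isClosed_closure (s := B k)))
      filter_upwards [eventually_ge_atTop k] with n hn
      simp only [ProbabilityMeasure.coe_mk]
      rw [Measure.map_apply_of_aemeasurable (hζ n) hF.measurableSet,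
        Measure.map_apply_of_aemeasurable (h.forall_aemeasurable n) isClosed_closure.measurableSet]
      refine measure_mono_ae ?_
      filter_upwards [hR n] with ω hω hωF
      exact subset_closure ⟨n, hn, _, hωF, hω⟩
    have hinter : P'.map ξ' (⋂ k, C k) ≤ P'.map ζ' F := by
      rw [Measure.map_apply_of_aemeasurable hζ' hF.measurableSet,
        Measure.map_apply_of_aemeasurable h.aemeasurable_limit
          (MeasurableSet.iInter fun k => isClosed_closure.measurableSet)]
      refine measure_mono_ae ?_
      filter_upwards [hlim] with ω hω hωC
      by_contra hωF
      obtain ⟨V, hV, hn⟩ := hω Fᶜ (hF.isOpen_compl.mem_nhds hωF)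
      obtain ⟨k, hk⟩ := eventually_atTop.1 hn
      obtain ⟨s, hsV, n, hkn, t, htF, hst⟩ :=
        mem_closure_iff_nhds.1 (mem_iInter.1 hωC k) V hV
      exact hk n hkn s hsV t hst htF
    refine le_trans ?_ hinter
    have : IsProbabilityMeasure (P'.map ξ') := Measure.isProbabilityMeasure_map h.aemeasurable_limit
    rw [hC.measure_iInter (fun k => isClosed_closure.measurableSet.nullMeasurableSet)
      ⟨Classical.arbitrary ι, measure_ne_top _ _⟩]
    exact le_iInf hk

/-! ### The projection on a closed convex set -/

section ProjectionLemmas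

variable {E : Type*} [NormedAddCommGroup E] [InnerProductSpace ℝ E] [FiniteDimensional ℝ E]
  {D : Set E}

theorem proj_mem (hne : D.Nonempty) (x : E) : proj D x ∈ closure D := (proj_spec hne x).1

theorem proj_eq_of_inner_le (hc : Convex ℝ D) (hne : D.Nonempty) {x z : E} (hz : z ∈ closure D)
    (h : ∀ w ∈ closure D, inner ℝ (x - z) (w - z) ≤ 0) : proj D x = z := by
  have h1 := h _ (proj_mem hne x)
  have h2 := proj_inner_le hc hne x z hz
  have e : inner ℝ (proj D x - z) (proj D x - z)
      = inner ℝ (x - z) (proj D x - z) + inner ℝ (x - proj D x) (z - proj D x) := by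
    simp only [inner_sub_left, inner_sub_right]
    ring
  have h3 : inner ℝ (proj D x - z) (proj D x - z) ≤ 0 := by linarith
  rw [real_inner_self_nonpos, sub_eq_zero] at h3
  exact h3

/-- The projection is constant along the ray from `Π(x)` through `x`. -/
theorem proj_add_smul (hc : Convex ℝ D) (hne : D.Nonempty) (x : E) {e : ℝ} (he : 0 ≤ e) :
    proj D (proj D x + e • (x - proj D x)) = proj D x := by
  refine proj_eq_of_inner_le hc hne (proj_mem hne x) fun w hw => ?_
  rw [add_sub_cancel_left, real_inner_smul_left]
  exact mul_nonpos_of_nonneg_of_nonpos he (proj_inner_le hc hne x w hw)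

/-- The map `x ↦ x - Π(x)` is monotone. -/
theorem inner_sub_proj_nonneg (hc : Convex ℝ D) (hne : D.Nonempty) (p q : E) :
    0 ≤ inner ℝ (p - q) ((p - proj D p) - (q - proj D q)) := by
  have h1 := proj_inner_le hc hne p _ (proj_mem hne q)
  have h2 := proj_inner_le hc hne q _ (proj_mem hne p)
  have h3 := real_inner_self_nonneg (x := (p - proj D p) - (q - proj D q))
  simp only [inner_sub_left, inner_sub_right] at *
  linarith [real_inner_comm p (proj D p), real_inner_comm p (proj D q), real_inner_comm q p,
    real_inner_comm q (proj D p), real_inner_comm q (proj D q),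
    real_inner_comm (proj D p) (proj D q)]

theorem norm_proj_sub_le (hc : Convex ℝ D) (hne : D.Nonempty) (p q : E) :
    ‖proj D p - proj D q‖ ≤ ‖p - q‖ := by
  have h1 := proj_inner_le hc hne p _ (proj_mem hne q)
  have h2 := proj_inner_le hc hne q _ (proj_mem hne p)
  have h3 : ‖proj D p - proj D q‖ * ‖proj D p - proj D q‖
      ≤ inner ℝ (p - q) (proj D p - proj D q) := by
    rw [← real_inner_self_eq_norm_mul_norm]
    simp only [inner_sub_left, inner_sub_right] at *
    linarith
  have h4 := real_inner_le_norm (p - q) (proj D p - proj D q)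
  by_contra! hlt
  nlinarith [norm_nonneg (p - q), norm_nonneg (proj D p - proj D q)]

theorem norm_sub_proj_le (hne : D.Nonempty) (x : E) {a : E} (ha : a ∈ closure D) :
    ‖x - proj D x‖ ≤ ‖x - a‖ := by
  rw [(proj_spec hne x).2, ← dist_eq_norm]
  exact Metric.infDist_le_dist_of_mem ha

/-- The displacement `x - Π(x)` has a uniformly large component in the direction away from the
centre of a ball contained in `D`. -/
theorem mul_norm_le_inner (hc : Convex ℝ D) (hne : D.Nonempty) {a : E} {ρ : ℝ} (hρ : 0 ≤ ρ)
    (hball : Metric.closedBall a ρ ⊆ D) (x : E) :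
    ρ * ‖x - proj D x‖ ≤ inner ℝ (x - a) (x - proj D x) := by
  set b := x - proj D x with hb
  rcases eq_or_ne b 0 with h0 | h0
  · rw [h0]; simp
  have hbn : 0 < ‖b‖ := norm_pos_iff.2 h0
  have hw : a + (ρ / ‖b‖) • b ∈ closure D := by
    refine subset_closure (hball ?_)
    rw [mem_closedBall_iff_norm, add_sub_cancel_left, norm_smul, Real.norm_of_nonneg (by positivity),
      div_mul_cancel₀ _ hbn.ne']
  have h := proj_inner_le hc hne x _ hw
  rw [← hb] at h
  have e : a + (ρ / ‖b‖) • b - proj D x = (ρ / ‖b‖) • b - (x - a) + b := by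
    rw [hb]; abel
  rw [e, inner_add_right, inner_sub_right, real_inner_smul_right,
    real_inner_self_eq_norm_mul_norm] at h
  have e2 : ρ / ‖b‖ * (‖b‖ * ‖b‖) = ρ * ‖b‖ := by field_simp
  rw [e2, real_inner_comm] at h
  nlinarith

end ProjectionLemmas

/-! ### Calculus of right-continuous integrands -/

section Calculus

variable {E : Type*} [NormedAddCommGroup E] [InnerProductSpace ℝ E] [FiniteDimensional ℝ E]
  [MeasurableSpace E] [BorelSpace E]

theorem norm_sq_primitive {f : ℝ → E} (hm : Measurable f)
    (hc : ∀ u, ContinuousWithinAt f (Ici u) u) (hi : ∀ a b, IntervalIntegrable f volume a b)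
    (w : E) (s v : ℝ) :
    IntervalIntegrable (fun u => inner ℝ (w + ∫ τ in s..u, f τ) (f u)) volume s v ∧
    ‖w + ∫ u in s..v, f u‖ ^ 2
      = ‖w‖ ^ 2 + 2 * ∫ u in s..v, inner ℝ (w + ∫ τ in s..u, f τ) (f u) := by
  have hW : Continuous fun u => w + ∫ τ in s..u, f τ :=
    continuous_const.add (intervalIntegral.continuous_primitive hi s)
  have hint : IntervalIntegrable (fun u => inner ℝ (w + ∫ τ in s..u, f τ) (f u)) volume s v := by
    obtain ⟨C, hC⟩ := isCompact_uIcc.exists_bound_of_continuousOn (s := uIcc s v) hW.continuousOn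
    refine ((hi s v).norm.const_mul C).mono_fun' ?_ ?_
    · exact (hW.measurable.inner hm).aestronglyMeasurable
    · refine (ae_restrict_iff' measurableSet_uIoc).2 (Eventually.of_forall fun u hu => ?_)
      exact (norm_inner_le_norm _ _).trans
        (mul_le_mul_of_nonneg_right (hC u (uIoc_subset_uIcc hu)) (norm_nonneg _))
  refine ⟨hint, ?_⟩
  have hderiv : ∀ u, HasDerivWithinAt (fun u => ‖w + ∫ τ in s..u, f τ‖ ^ 2)
      (2 * inner ℝ (w + ∫ τ in s..u, f τ) (f u)) (Ioi u) u := fun u => by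
    have h1 : HasDerivWithinAt (fun u => ∫ τ in s..u, f τ) (f u) (Ioi u) u :=
      (intervalIntegral.integral_hasDerivWithinAt_right (s := Ici u) (t := Ioi u) (hi s u)
        (hm.stronglyMeasurable.stronglyMeasurableAtFilter)
        ((hc u).mono Ioi_subset_Ici_self)).mono Ioi_subset_Ici_self
    exact (h1.const_add w).norm_sq
  have h := intervalIntegral.integral_eq_sub_of_hasDeriv_right (a := s) (b := v)
    (hW.norm.pow 2).continuousOn (fun u _ => hderiv u) (hint.const_mul 2)
  rw [intervalIntegral.integral_const_mul] at h
  rw [h]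
  simp

end Calculus

namespace Cadlag

section Normed

variable {E : Type*} [NormedAddCommGroup E]

theorem exists_norm_le (x : Cadlag E) (T : ℝ≥0) : ∃ B, 0 ≤ B ∧ ∀ u ≤ T, ‖x u‖ ≤ B := by
  obtain ⟨r, t, ht, htr⟩ := x.exists_isPartition one_pos (T + 1)
  refine ⟨∑ i ∈ Finset.range r, ‖x (t i)‖ + 1, by positivity, fun u hu => ?_⟩
  obtain ⟨i, hi, h1, h2⟩ := ht.exists_mem (u := u) (by rw [htr]; exact hu.trans_lt (by simp))
  have h3 := ht.dist_le i hi u h1 h2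
  rw [dist_eq_norm] at h3
  have h4 := Finset.single_le_sum (f := fun i => ‖x (t i)‖) (fun i _ => norm_nonneg _)
    (Finset.mem_range.2 hi)
  have h5 := norm_sub_norm_le (x u) (x (t i))
  linarith

end Normed

end Cadlag

/-! ### A priori estimates for the penalized equation -/

section Penalized

variable {E : Type*} [NormedAddCommGroup E] [InnerProductSpace ℝ E] [FiniteDimensional ℝ E]
  [MeasurableSpace E] [BorelSpace E] {D : Set E}

/-- The displacement `x_s - Π(x_s)` as a function on `ℝ`, constant on the negative half line. -/
noncomputable def penalty (D : Set E) (x : Cadlag E) (s : ℝ) : E :=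
  x s.toNNReal - proj D (x s.toNNReal)

theorem measurable_penalty (hc : Convex ℝ D) (hne : D.Nonempty) (x : Cadlag E) :
    Measurable (penalty D x) := by
  have h := x.measurable_toFun.comp measurable_real_toNNReal
  exact h.sub ((continuous_proj hc hne).measurable.comp h)

omit [MeasurableSpace E] [BorelSpace E] in
theorem continuousWithinAt_penalty (hc : Convex ℝ D) (hne : D.Nonempty) (x : Cadlag E) (u : ℝ) :
    ContinuousWithinAt (penalty D x) (Ici u) u := by
  have h : ContinuousWithinAt (fun s : ℝ => x s.toNNReal) (Ici u) u :=
    (x.right_continuous u.toNNReal).comp continuous_real_toNNReal.continuousWithinAt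
      fun s hs => Real.toNNReal_mono hs
  exact h.sub ((continuous_proj hc hne).continuousAt.comp_continuousWithinAt h)

theorem intervalIntegrable_penalty (hc : Convex ℝ D) (hne : D.Nonempty) (x : Cadlag E) (a b : ℝ) :
    IntervalIntegrable (penalty D x) volume a b := by
  obtain ⟨B, -, hB⟩ := x.exists_norm_le (max a b).toNNReal
  obtain ⟨p, hp⟩ := hne.closure
  refine (intervalIntegrable_const (c := B + ‖p‖)).mono_fun'
    (measurable_penalty hc hne x).aestronglyMeasurable ?_
  refine (ae_restrict_iff' measurableSet_uIoc).2 (Eventually.of_forall fun u hu => ?_)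
  refine (norm_sub_proj_le hne _ hp).trans ((norm_sub_le _ _).trans ?_)
  exact add_le_add_left (hB _ (Real.toNNReal_mono hu.2)) _

/-- The penalized equation with parameter `c` in a general Euclidean space; on
`EuclideanSpace ℝ (Fin d)` it is `IsPenalizedSolution` by definition. -/
def PenalizedEq (D : Set E) (c : ℝ) (y x : Cadlag E) : Prop :=
  ∀ t : ℝ≥0, x t = y t - c • ∫ s in (0 : ℝ)..t, penalty D x s

namespace PenalizedEq

variable {c : ℝ} {y x : Cadlag E}

theorem eq_add (hc : Convex ℝ D) (hne : D.Nonempty) (h : PenalizedEq D c y x) (s u : ℝ≥0) :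
    x u = x s + (y u - y s) - c • ∫ τ in (s : ℝ)..u, penalty D x τ := by
  have e := intervalIntegral.integral_add_adjacent_intervals
    (intervalIntegrable_penalty hc hne x 0 s) (intervalIntegrable_penalty hc hne x s u)
  rw [h u, h s, ← e, smul_add]
  abel

omit [FiniteDimensional ℝ E] [MeasurableSpace E] [BorelSpace E] in
theorem zero (h : PenalizedEq D c y x) : x 0 = y 0 := by
  have := h 0
  simpa using this

/-- As long as `y` moves by at most half the radius of a ball contained in `D`, the penalization
term moves `x` towards the centre of the ball, which controls its total variation. -/
theorem variation_le (hc : Convex ℝ D) (hne : D.Nonempty) (hc0 : 0 ≤ c)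
    (h : PenalizedEq D c y x) {a : E} {ρ : ℝ} (hρ : 0 < ρ) (hball : Metric.closedBall a ρ ⊆ D)
    {s v : ℝ≥0} (hsv : s ≤ v) (hy : ∀ u, s ≤ u → u < v → ‖y u - y s‖ ≤ ρ / 2) :
    ‖x s - a - c • ∫ τ in (s : ℝ)..v, penalty D x τ‖ ^ 2
      + ρ * (c * ∫ τ in (s : ℝ)..v, ‖penalty D x τ‖) ≤ ‖x s - a‖ ^ 2 := by
  set f : ℝ → E := fun u => -(c • penalty D x u) with hf
  have hsv' : (s : ℝ) ≤ v := hsv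
  have hi := intervalIntegrable_penalty hc hne x
  have hfi : ∀ a b, IntervalIntegrable f volume a b := fun a b => ((hi a b).smul c).neg
  have hF : ∀ u : ℝ, ∫ τ in (s : ℝ)..u, f τ = -(c • ∫ τ in (s : ℝ)..u, penalty D x τ) := fun u => by
    rw [hf, intervalIntegral.integral_neg, intervalIntegral.integral_smul]
  obtain ⟨h1, h2⟩ := norm_sq_primitive (f := f)
    ((measurable_penalty hc hne x).const_smul c).neg
    (fun u => ((continuousWithinAt_penalty hc hne x u).const_smul c).neg) hfi (x s - a) s v
  have h3 : ∫ u in (s : ℝ)..v, inner ℝ (x s - a + ∫ τ in (s : ℝ)..u, f τ) (f u)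
      ≤ ∫ u in (s : ℝ)..v, -(ρ / 2 * c) * ‖penalty D x u‖ := by
    refine intervalIntegral.integral_mono_on_of_le_Ioo hsv' h1 ((hi _ _).norm.const_mul _) ?_
    intro u hu
    lift u to ℝ≥0 using s.coe_nonneg.trans hu.1.le
    have hsu : s < u := hu.1
    have huv : u < v := hu.2
    have e1 : x s - a + ∫ τ in (s : ℝ)..u, f τ = (x u - a) - (y u - y s) := by
      rw [hF, h.eq_add hc hne s u]
      abel
    have e2 : f u = -(c • (x u - proj D (x u))) := by simp [hf, penalty]
    have e3 : penalty D x u = x u - proj D (x u) := by simp [penalty]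
    rw [e1, e2, e3, inner_neg_right, real_inner_smul_right, inner_sub_left]
    have h4 := mul_norm_le_inner hc hne hρ.le hball (x u)
    have h5 := (real_inner_le_norm (y u - y s) (x u - proj D (x u))).trans
      (mul_le_mul_of_nonneg_right (hy u hsu.le huv) (norm_nonneg _))
    nlinarith
  rw [intervalIntegral.integral_const_mul] at h3
  have e : x s - a - c • ∫ τ in (s : ℝ)..v, penalty D x τ = x s - a + ∫ τ in (s : ℝ)..v, f τ := by
    rw [hF]; abel
  rw [e]
  change ‖x s - a + ∫ τ in (s : ℝ)..v, f τ‖ ^ 2 = _ at h2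
  linarith

/-- Bounds for `x` and for the total variation of the penalization term that depend on `y` only
through its supremum norm and the number of pieces of a partition. -/
theorem bound (hc : Convex ℝ D) (hne : D.Nonempty) (hc0 : 0 ≤ c)
    (h : PenalizedEq D c y x) {a : E} {ρ : ℝ} (hρ : 0 < ρ) (hball : Metric.closedBall a ρ ⊆ D)
    {r : ℕ} {t : ℕ → ℝ≥0} (ht : y.IsPartition (ρ / 2) r t) {B : ℝ} (hB : ∀ u ≤ t r, ‖y u‖ ≤ B) :
    (∀ u ≤ t r, ‖x u - a‖ ≤ ‖a‖ + B + 2 * B * r) ∧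
      c * ∫ τ in (0 : ℝ)..t r, ‖penalty D x τ‖ ≤ r * ((‖a‖ + B + 2 * B * r) ^ 2 / ρ) := by
  have hB0 : 0 ≤ B := (norm_nonneg _).trans (hB _ le_rfl)
  have hi := intervalIntegrable_penalty hc hne x
  suffices H : ∀ i ≤ r, (∀ u ≤ t i, ‖x u - a‖ ≤ ‖a‖ + B + 2 * B * i) ∧
      c * ∫ τ in (0 : ℝ)..t i, ‖penalty D x τ‖ ≤ i * ((‖a‖ + B + 2 * B * r) ^ 2 / ρ) from H r le_rfl
  intro i hir
  induction i with
  | zero =>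
    rw [ht.zero]
    refine ⟨fun u hu => ?_, by simp⟩
    rw [le_antisymm hu zero_le, h.zero]
    have := norm_sub_le (y 0) a
    have := hB 0 zero_le
    push_cast
    linarith
  | succ i ih =>
    obtain ⟨ih1, ih2⟩ := ih (by omega)
    have hlt := ht.lt_succ i hir
    have hle : t (i + 1) ≤ t r := ht.monotone hir le_rfl
    have hRi : ‖x (t i) - a‖ ≤ ‖a‖ + B + 2 * B * i := ih1 _ le_rfl
    have key : ∀ u, t i ≤ u → u ≤ t (i + 1) →
        ‖x (t i) - a - c • ∫ τ in (t i : ℝ)..u, penalty D x τ‖ ^ 2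
      + ρ * (c * ∫ τ in (t i : ℝ)..u, ‖penalty D x τ‖) ≤ ‖x (t i) - a‖ ^ 2 := fun u h1 h2 =>
      h.variation_le hc hne hc0 hρ hball h1 fun w h3 h4 => by
        rw [← dist_eq_norm]
        exact ht.dist_le i hir w h3 (h4.trans_le h2)
    have hnn : ∀ u, t i ≤ u → 0 ≤ c * ∫ τ in (t i : ℝ)..u, ‖penalty D x τ‖ := fun u hu =>
      mul_nonneg hc0 (intervalIntegral.integral_nonneg hu fun _ _ => norm_nonneg _)
    refine ⟨fun u hu => ?_, ?_⟩
    · rcases le_total u (t i) with h1 | h1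
      · have := ih1 u h1
        push_cast
        linarith
      · have h2 := key u h1 hu
        have h3 : ‖x (t i) - a - c • ∫ τ in (t i : ℝ)..u, penalty D x τ‖ ≤ ‖x (t i) - a‖ := by
          refine le_of_sq_le_sq ?_ (norm_nonneg _)
          nlinarith [hnn u h1]
        have e : x u - a = (x (t i) - a - c • ∫ τ in (t i : ℝ)..u, penalty D x τ)
            + (y u - y (t i)) := by
          rw [h.eq_add hc hne (t i) u]
          abel
        have h4 := norm_add_le (x (t i) - a - c • ∫ τ in (t i : ℝ)..u, penalty D x τ)
          (y u - y (t i))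
        rw [← e] at h4
        have h5 := norm_sub_le (y u) (y (t i))
        have h6 := hB u (hu.trans hle)
        have h7 := hB (t i) (hlt.le.trans hle)
        push_cast
        linarith
    · have h2 := key _ hlt.le le_rfl
      have e := intervalIntegral.integral_add_adjacent_intervals (hi 0 (t i)).norm
        (hi (t i) (t (i + 1))).norm
      rw [← e, mul_add]
      have h3 : c * ∫ τ in (t i : ℝ)..t (i + 1), ‖penalty D x τ‖
          ≤ (‖a‖ + B + 2 * B * r) ^ 2 / ρ := by
        rw [le_div_iff₀ hρ]
        have h4 : (i : ℝ) ≤ r := by exact_mod_cast (by omega : i ≤ r)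
        have h5 : ‖x (t i) - a‖ ≤ ‖a‖ + B + 2 * B * r := hRi.trans (by gcongr)
        have h6 : ‖x (t i) - a‖ ^ 2 ≤ (‖a‖ + B + 2 * B * r) ^ 2 := by gcongr
        nlinarith [sq_nonneg ‖x (t i) - a - c • ∫ τ in (t i : ℝ)..t (i + 1), penalty D x τ‖]
      push_cast
      linarith

/-- On an interval where `y` moves by at most `η`, the path `x`, with the motion of `y` removed,
stays close to the exponential relaxation `Π(x_s) + e^{-c (u - s)} (x_s - Π(x_s))`, which solves the
equation with constant `y`. -/
theorem norm_sub_relaxation_le (hc : Convex ℝ D) (hne : D.Nonempty) (hc0 : 0 ≤ c)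
    (h : PenalizedEq D c y x) {s v : ℝ≥0} {η V A : ℝ}
    (hy : ∀ u, s ≤ u → u < v → ‖y u - y s‖ ≤ η)
    (hV : c * ∫ τ in (s : ℝ)..v, ‖penalty D x τ‖ ≤ V) (hA : ‖x s - proj D (x s)‖ ≤ A)
    {u : ℝ≥0} (hsu : s ≤ u) (huv : u ≤ v) (hη : 0 ≤ η) :
    ‖(x s - c • ∫ τ in (s : ℝ)..u, penalty D x τ)
      - (proj D (x s) + Real.exp (-(c * (u - s))) • (x s - proj D (x s)))‖
      ≤ √(2 * η * (V + A)) := by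
  set b := x s - proj D (x s) with hb
  set e : ℝ → ℝ := fun τ => Real.exp (-(c * (τ - s))) with he
  have hec : Continuous e := by fun_prop
  have hi := intervalIntegrable_penalty hc hne x
  set f : ℝ → E := fun τ => (c * e τ) • b - c • penalty D x τ with hf
  have hgi : ∀ a b', IntervalIntegrable (fun τ => (c * e τ) • b) volume a b' := fun a b' =>
    (Continuous.smul (by fun_prop) continuous_const).intervalIntegrable a b'
  have hci : ∀ a b', IntervalIntegrable (fun τ => c • penalty D x τ) volume a b' := fun a b' =>
    (hi a b').smul c
  have hfi : ∀ a b', IntervalIntegrable f volume a b' := fun a b' => (hgi a b').sub (hci a b')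
  have hce : ∀ u' : ℝ, ∫ τ in (s : ℝ)..u', c * e τ = 1 - e u' := fun u' => by
    have hd : ∀ τ ∈ uIcc (s : ℝ) u', HasDerivAt (fun τ => -e τ) (c * e τ) τ := fun τ _ => by
      have h1 : HasDerivAt (fun τ : ℝ => -(c * (τ - s))) (-(c * 1)) τ :=
        (((hasDerivAt_id τ).sub_const (s : ℝ)).const_mul c).neg
      refine h1.exp.neg.congr_deriv ?_
      simp only [he]
      ring
    rw [intervalIntegral.integral_eq_sub_of_hasDerivAt hd
      ((continuous_const.mul hec).intervalIntegrable _ _)]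
    simp [he]
    ring
  have hF : ∀ u' : ℝ, (0 : E) + ∫ τ in (s : ℝ)..u', f τ
      = (x s - c • ∫ τ in (s : ℝ)..u', penalty D x τ) - (proj D (x s) + e u' • b) := fun u' => by
    simp only [hf]
    rw [intervalIntegral.integral_sub (hgi _ _) (hci _ _),
      intervalIntegral.integral_smul_const, hce, intervalIntegral.integral_smul, sub_smul, one_smul,
      hb]
    abel
  have hsu' : (s : ℝ) ≤ u := hsu
  obtain ⟨h1, h2⟩ := norm_sq_primitive (f := f)
    (((continuous_const.mul hec).smul continuous_const).measurable.sub
      ((measurable_penalty hc hne x).const_smul c))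
    (fun u => (((continuous_const.mul hec).smul continuous_const).continuousWithinAt).sub
      ((continuousWithinAt_penalty hc hne x u).const_smul c)) hfi 0 s u
  have hnormi := (hi s u).norm.const_mul c
  have hei : IntervalIntegrable (fun τ => c * e τ * A) volume s u :=
    ((continuous_const.mul hec).mul continuous_const).intervalIntegrable _ _
  have h3 : ∫ u' in (s : ℝ)..u, inner ℝ (0 + ∫ τ in (s : ℝ)..u', f τ) (f u')
      ≤ ∫ u' in (s : ℝ)..u, η * (c * ‖penalty D x u'‖ + c * e u' * A) := by
    refine intervalIntegral.integral_mono_on_of_le_Ioo hsu' h1 ((hnormi.add hei).const_mul _) ?_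
    intro τ hτ
    lift τ to ℝ≥0 using s.coe_nonneg.trans hτ.1.le
    have hsτ : s < τ := hτ.1
    have hτv : τ < v := lt_of_lt_of_le hτ.2 huv
    have he0 : 0 ≤ e τ := (Real.exp_pos _).le
    -- `q` is the relaxation at time `τ`; its displacement from the projection is `e τ • b`
    set q := proj D (x s) + e τ • b with hq
    have hqp : q - proj D q = e τ • b := by
      rw [hq, hb, proj_add_smul hc hne _ he0, add_sub_cancel_left]
    have e1 : 0 + ∫ τ' in (s : ℝ)..τ, f τ' = (x τ - q) - (y τ - y s) := by
      rw [hF, h.eq_add hc hne s τ, hq]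
      abel
    have e3 : penalty D x τ = x τ - proj D (x τ) := by simp [penalty]
    have e2 : f τ = -(c • ((x τ - proj D (x τ)) - (q - proj D q))) := by
      rw [hqp]
      simp only [hf, e3, smul_sub, smul_smul]
      abel
    rw [e1, e2, e3, inner_neg_right, real_inner_smul_right, inner_sub_left]
    have h4 := inner_sub_proj_nonneg hc hne (x τ) q
    have h5 := real_inner_le_norm (y τ - y s) ((x τ - proj D (x τ)) - (q - proj D q))
    have h6 : ‖(x τ - proj D (x τ)) - (q - proj D q)‖ ≤ ‖x τ - proj D (x τ)‖ + e τ * A := by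
      refine (norm_sub_le _ _).trans ?_
      rw [hqp, norm_smul, Real.norm_of_nonneg he0]
      gcongr
    have h7 : inner ℝ (y τ - y s) ((x τ - proj D (x τ)) - (q - proj D q))
        ≤ η * (‖x τ - proj D (x τ)‖ + e τ * A) :=
      h5.trans (mul_le_mul (hy τ hsτ.le hτv) h6 (norm_nonneg _) hη)
    nlinarith [mul_le_mul_of_nonneg_left h7 hc0, mul_nonneg hc0 h4]
  have h8 : ∫ u' in (s : ℝ)..u, η * (c * ‖penalty D x u'‖ + c * e u' * A) ≤ η * (V + A) := by
    rw [intervalIntegral.integral_const_mul, intervalIntegral.integral_add hnormi hei,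
      intervalIntegral.integral_const_mul, intervalIntegral.integral_mul_const, hce]
    have hA0 : 0 ≤ A := (norm_nonneg _).trans hA
    have h9 : (1 - e u) * A ≤ A := by
      nlinarith [(Real.exp_pos (-(c * ((u : ℝ) - s)))).le]
    have h10 : ∫ τ in (s : ℝ)..u, ‖penalty D x τ‖ ≤ ∫ τ in (s : ℝ)..v, ‖penalty D x τ‖ :=
      intervalIntegral.integral_mono_interval le_rfl hsu' huv
        (Eventually.of_forall fun _ => norm_nonneg _) (hi s v).norm
    have h11 := mul_le_mul_of_nonneg_left h10 hc0
    gcongr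
    exact h11.trans hV
  rw [← hF u]
  apply Real.le_sqrt_of_sq_le
  rw [h2]
  simp only [norm_zero]
  linarith

section Piece

variable (hc : Convex ℝ D) (hne : D.Nonempty) (hc0 : 0 ≤ c) (h : PenalizedEq D c y x)
  {s v : ℝ≥0} {η V A : ℝ} (hy : ∀ u, s ≤ u → u < v → ‖y u - y s‖ ≤ η)
  (hV : c * ∫ τ in (s : ℝ)..v, ‖penalty D x τ‖ ≤ V) (hA : ‖x s - proj D (x s)‖ ≤ A)
  {u : ℝ≥0} (hsu : s ≤ u) (huv : u ≤ v) (hη : 0 ≤ η)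

include hc hne hc0 h hy hV hA hsu huv hη

theorem norm_primitive_sub_proj_le :
    ‖(x s - c • ∫ τ in (s : ℝ)..u, penalty D x τ) - proj D (x s)‖
      ≤ √(2 * η * (V + A)) + Real.exp (-(c * (u - s))) * A := by
  have h1 := h.norm_sub_relaxation_le hc hne hc0 hy hV hA hsu huv hη
  set e := Real.exp (-(c * ((u : ℝ) - s)))
  have h2 : ‖e • (x s - proj D (x s))‖ ≤ e * A := by
    rw [norm_smul, Real.norm_of_nonneg (Real.exp_pos _).le]
    gcongr
  have h3 := norm_add_le ((x s - c • ∫ τ in (s : ℝ)..u, penalty D x τ)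
      - (proj D (x s) + e • (x s - proj D (x s)))) (e • (x s - proj D (x s)))
  have e1 : (x s - c • ∫ τ in (s : ℝ)..u, penalty D x τ)
      - (proj D (x s) + e • (x s - proj D (x s))) + e • (x s - proj D (x s))
      = (x s - c • ∫ τ in (s : ℝ)..u, penalty D x τ) - proj D (x s) := by abel
  rw [e1] at h3
  linarith

theorem norm_sub_proj_start_le (hlt : u < v) :
    ‖x u - proj D (x s)‖ ≤ η + √(2 * η * (V + A)) + Real.exp (-(c * (u - s))) * A := by
  have h1 := h.norm_primitive_sub_proj_le hc hne hc0 hy hV hA hsu huv hη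
  have e1 : x u - proj D (x s) = (y u - y s)
      + ((x s - c • ∫ τ in (s : ℝ)..u, penalty D x τ) - proj D (x s)) := by
    rw [h.eq_add hc hne s u]; abel
  rw [e1]
  have := norm_add_le (y u - y s) ((x s - c • ∫ τ in (s : ℝ)..u, penalty D x τ) - proj D (x s))
  linarith [hy u hsu hlt]

theorem norm_proj_sub_proj_start_le (hlt : u < v) :
    ‖proj D (x u) - proj D (x s)‖ ≤ η + √(2 * η * (V + A)) := by
  have h1 := h.norm_sub_relaxation_le hc hne hc0 hy hV hA hsu huv hη
  set e := Real.exp (-(c * ((u : ℝ) - s)))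
  have h2 := norm_proj_sub_le hc hne (x u) (proj D (x s) + e • (x s - proj D (x s)))
  rw [proj_add_smul hc hne _ (Real.exp_pos _).le] at h2
  have e1 : x u - (proj D (x s) + e • (x s - proj D (x s))) = (y u - y s)
      + ((x s - c • ∫ τ in (s : ℝ)..u, penalty D x τ)
        - (proj D (x s) + e • (x s - proj D (x s)))) := by
    rw [h.eq_add hc hne s u]; abel
  rw [e1] at h2
  have := norm_add_le (y u - y s) ((x s - c • ∫ τ in (s : ℝ)..u, penalty D x τ)
        - (proj D (x s) + e • (x s - proj D (x s))))
  linarith [hy u hsu hlt]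

end Piece

end PenalizedEq

end Penalized

/-! ### The oscillation of penalized paths -/

namespace Cadlag

section Neighbourhoods

variable {E F : Type*} [PseudoMetricSpace E] [PseudoMetricSpace F]

theorem map_fst_mem_skorokhodNhd {w w' : Cadlag (E × F)} {M : ℝ≥0} {η : ℝ}
    (h : w' ∈ skorokhodNhd w M η) :
    w'.map Prod.fst continuous_fst ∈ skorokhodNhd (w.map Prod.fst continuous_fst) M η := by
  obtain ⟨lam, h1, h2⟩ := h
  exact ⟨lam, h1, fun s hs => (le_max_left _ _).trans (h2 s hs)⟩

theorem map_snd_mem_skorokhodNhd {w w' : Cadlag (E × F)} {M : ℝ≥0} {η : ℝ}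
    (h : w' ∈ skorokhodNhd w M η) :
    w'.map Prod.snd continuous_snd ∈ skorokhodNhd (w.map Prod.snd continuous_snd) M η := by
  obtain ⟨lam, h1, h2⟩ := h
  exact ⟨lam, h1, fun s hs => (le_max_right _ _).trans (h2 s hs)⟩

theorem map_fst_mem_skorokhodNhd_of_prodMk {y : Cadlag E} {z : Cadlag F} {w' : Cadlag (E × F)}
    {M : ℝ≥0} {η : ℝ} (h : w' ∈ (y.prodMk z).skorokhodNhd M η) :
    w'.map Prod.fst continuous_fst ∈ y.skorokhodNhd M η := by
  obtain ⟨lam, h1, h2⟩ := h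
  exact ⟨lam, h1, fun s hs => (le_max_left _ _).trans (h2 s hs)⟩

theorem continuous_map_snd : Continuous fun w : Cadlag (E × F) => w.map Prod.snd continuous_snd := by
  refine continuous_iff_continuousAt.2 fun w S hS => ?_
  obtain ⟨N, ε, hε, h⟩ := mem_nhds_iff_skorokhodNhd.1 hS
  exact mem_map.2 (mem_of_superset (skorokhodNhd_mem_nhds w N hε) fun w' hw' =>
    h (map_snd_mem_skorokhodNhd hw'))

theorem IsPartition.mono {x : Cadlag E} {η η' : ℝ} {r : ℕ} {t : ℕ → ℝ≥0}
    (h : x.IsPartition η r t) (hη : η ≤ η') : x.IsPartition η' r t :=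
  ⟨h.zero, h.lt_succ, fun i hi u h1 h2 => (h.dist_le i hi u h1 h2).trans hη⟩

theorem IsPartition.fst {w : Cadlag (E × F)} {η : ℝ} {r : ℕ} {t : ℕ → ℝ≥0}
    (h : w.IsPartition η r t) : (w.map Prod.fst continuous_fst).IsPartition η r t :=
  ⟨h.zero, h.lt_succ, fun i hi u h1 h2 => (le_max_left _ _).trans (h.dist_le i hi u h1 h2)⟩

theorem IsPartition.snd {w : Cadlag (E × F)} {η : ℝ} {r : ℕ} {t : ℕ → ℝ≥0}
    (h : w.IsPartition η r t) : (w.map Prod.snd continuous_snd).IsPartition η r t :=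
  ⟨h.zero, h.lt_succ, fun i hi u h1 h2 => (le_max_right _ _).trans (h.dist_le i hi u h1 h2)⟩

/-- A time change transports partitions to uniformly close functions. -/
theorem IsPartition.comp {x y : Cadlag E} {η η' : ℝ} {r : ℕ} {t : ℕ → ℝ≥0}
    (h : x.IsPartition η r t) (lam : ℝ≥0 ≃o ℝ≥0)
    (hy : ∀ s ≤ t r, dist (y (lam s)) (x s) ≤ η') :
    y.IsPartition (η + 2 * η') r fun i => lam (t i) where
  zero := by rw [h.zero]; exact map_bot lam
  lt_succ i hi := lam.strictMono (h.lt_succ i hi)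
  dist_le i hi u h1 h2 := by
    obtain ⟨s, rfl⟩ := lam.surjective u
    have h3 := lam.le_iff_le.1 h1
    have h4 := lam.lt_iff_lt.1 h2
    have h5 := h.dist_le i hi s h3 h4
    have h6 := hy s (h4.le.trans (h.monotone hi le_rfl))
    have h7 := hy (t i) (h.monotone hi.le le_rfl)
    have h8 := dist_triangle4 (y (lam s)) (x s) (x (t i)) (y (lam (t i)))
    rw [dist_comm (x (t i))] at h8
    linarith

end Neighbourhoods

end Cadlag

theorem NNReal.le_add_of_dist_le {s t : ℝ≥0} {ε : ℝ} (h : dist s t ≤ ε) :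
    (s : ℝ) ≤ t + ε ∧ (t : ℝ) ≤ s + ε := by
  have := abs_le.1 ((NNReal.dist_eq _ _).symm.le.trans h)
  constructor <;> linarith [this.1, this.2]

theorem exists_pos_add_sqrt_le (C : ℝ) {ε : ℝ} (hε : 0 < ε) :
    ∃ η, 0 < η ∧ η + √(2 * η * C) ≤ ε := by
  have h : Tendsto (fun η : ℝ => η + √(2 * η * C)) (𝓝 0) (𝓝 0) := by
    have : Continuous fun η : ℝ => η + √(2 * η * C) := by fun_prop
    simpa using this.tendsto 0
  obtain ⟨η, h1, h2⟩ := (((h.eventually_lt_const hε).filter_mono nhdsWithin_le_nhds).and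
    (self_mem_nhdsWithin (s := Ioi 0))).exists
  exact ⟨η, h2, h1.le⟩

theorem exists_exp_mul_le {γ : ℝ} (hγ : 0 < γ) (C : ℝ) {ε : ℝ} (hε : 0 < ε) :
    ∃ c₀, 0 ≤ c₀ ∧ ∀ c ≥ c₀, Real.exp (-(c * γ)) * C ≤ ε := by
  have h : Tendsto (fun c : ℝ => Real.exp (-(c * γ)) * C) atTop (𝓝 (0 * C)) :=
    (Real.tendsto_exp_neg_atTop_nhds_zero.comp (tendsto_id.atTop_mul_const hγ)).mul_const C
  rw [zero_mul] at h
  obtain ⟨c₀, hc₀⟩ := eventually_atTop.1 (h.eventually_lt_const hε)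
  exact ⟨max c₀ 0, le_max_right _ _, fun c hc => (hc₀ c ((le_max_left _ _).trans hc)).le⟩

section Oscillation

variable {E : Type*} [NormedAddCommGroup E] [InnerProductSpace ℝ E] [FiniteDimensional ℝ E]
  [MeasurableSpace E] [BorelSpace E] {D : Set E}

theorem mul_integral_norm_penalty_mono (hc : Convex ℝ D) (hne : D.Nonempty) {c : ℝ} (hc0 : 0 ≤ c)
    (x : Cadlag E) {s v T : ℝ≥0} (hsv : s ≤ v) (hvT : v ≤ T) :
    c * ∫ τ in (s : ℝ)..v, ‖penalty D x τ‖ ≤ c * ∫ τ in (0 : ℝ)..T, ‖penalty D x τ‖ :=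
  mul_le_mul_of_nonneg_left (intervalIntegral.integral_mono_interval s.coe_nonneg hsv hvT
    (Eventually.of_forall fun _ => norm_nonneg _) (intervalIntegrable_penalty hc hne x 0 T).norm)
    hc0

/-- The a priori bounds hold uniformly in a neighbourhood of `y` and in the penalization
parameter. -/
theorem exists_uniform_bound (hopen : IsOpen D) (hc : Convex ℝ D) (hne : D.Nonempty)
    (y : Cadlag E) (T : ℝ≥0) :
    ∃ M : ℝ≥0, ∃ η C : ℝ, 0 < η ∧ 0 ≤ C ∧ ∀ y' ∈ y.skorokhodNhd M η, ∀ c : ℝ, 0 ≤ c → ∀ x',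
      PenalizedEq D c y' x' → (∀ u ≤ T, ‖x' u - proj D (x' u)‖ ≤ C) ∧
        ∀ s v : ℝ≥0, s ≤ v → v ≤ T → c * ∫ τ in (s : ℝ)..v, ‖penalty D x' τ‖ ≤ C := by
  obtain ⟨a, ha⟩ := hne
  obtain ⟨ρ, hρ, hball⟩ := Metric.nhds_basis_closedBall.mem_iff.1 (hopen.mem_nhds ha)
  obtain ⟨r, t, ht, htr⟩ := y.exists_isPartition (show 0 < ρ / 4 by positivity) (T + 1)
  obtain ⟨B, hB0, hB⟩ := y.exists_norm_le (T + 1)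
  set R := ‖a‖ + (B + 1) + 2 * (B + 1) * r
  have hη : 0 < min (ρ / 8) 1 := lt_min (by positivity) one_pos
  refine ⟨T + 1, min (ρ / 8) 1, max R (r * (R ^ 2 / ρ)), hη, le_max_of_le_left (by positivity), ?_⟩
  rintro y' ⟨lam, h1, h2⟩ c hc0 x' hx'
  have hpart := (ht.comp lam (y := y') (η' := min (ρ / 8) 1) fun s hs => h2 s (hs.trans htr.le)).mono
    (η' := ρ / 2) (by linarith [min_le_left (ρ / 8) 1])
  have hTlam : T ≤ lam (t r) := by
    have h3 := (NNReal.le_add_of_dist_le (h1 (t r))).2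
    rw [htr] at h3 ⊢
    push_cast at h3
    have : (T : ℝ) ≤ lam (T + 1) := by linarith [min_le_right (ρ / 8) 1]
    exact_mod_cast this
  obtain ⟨h4, h5⟩ := hx'.bound hc ⟨a, ha⟩ hc0 hρ hball hpart (B := B + 1) fun u hu => by
    obtain ⟨s, rfl⟩ := lam.surjective u
    have hs : s ≤ T + 1 := (lam.le_iff_le.1 hu).trans htr.le
    have h6 := h2 s hs
    rw [dist_eq_norm] at h6
    have := norm_sub_norm_le (y' (lam s)) (y s)
    linarith [hB s hs, min_le_right (ρ / 8) 1]
  refine ⟨fun u hu => ?_, fun s v hsv hvT => ?_⟩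
  · exact (norm_sub_proj_le ⟨a, ha⟩ _ (subset_closure ha)).trans
      ((h4 u (hu.trans hTlam)).trans (le_max_left _ _))
  · exact (mul_integral_norm_penalty_mono hc ⟨a, ha⟩ hc0 x' hsv (hvT.trans hTlam)).trans
      (h5.trans (le_max_right _ _))

/-- Locally uniformly in `(y, z)`, the modulus of a penalized path and `z` is small when the
penalization parameter is large. On each piece of a common partition the path has settled near
a point of the closed domain long before the piece ends, so of the increment of the path up to `u`
and that of `z` from `u` on, at most one can be large. -/
theorem exists_jakubowskiModulus_le (hopen : IsOpen D) (hc : Convex ℝ D) (hne : D.Nonempty)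
    {F : Type*} [PseudoMetricSpace F] (w : Cadlag (E × F)) {ε : ℝ} (hε : 0 < ε) (q : ℝ≥0) :
    ∃ M : ℝ≥0, ∃ η c₀ δ₀ : ℝ, 0 < η ∧ 0 < δ₀ ∧ ∀ w' ∈ w.skorokhodNhd M η, ∀ c ≥ c₀, ∀ x',
      PenalizedEq D c (w'.map Prod.fst continuous_fst) x' → ∀ δ ≤ δ₀,
        x'.jakubowskiModulus (w'.map Prod.snd continuous_snd) δ q ≤ ENNReal.ofReal ε := by
  obtain ⟨M, η₀, C, hη₀, hC, hbound⟩ :=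
    exists_uniform_bound hopen hc hne (w.map Prod.fst continuous_fst) (q + 2)
  obtain ⟨η, hη, hηle⟩ := exists_pos_add_sqrt_le (C + C) (show 0 < ε / 4 by positivity)
  have hηε : η ≤ ε / 4 := (le_add_of_nonneg_right (Real.sqrt_nonneg _)).trans hηle
  obtain ⟨r, t, ht, htr⟩ := w.exists_isPartition (show 0 < η / 3 by positivity) (q + 1)
  obtain ⟨γ, hγ, hgap⟩ := ht.exists_gap
  obtain ⟨c₀, hc₀, hexp⟩ := exists_exp_mul_le (show 0 < γ / 4 by positivity) C
    (show 0 < ε / 8 by positivity)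
  set η₁ := min (min η₀ (1 / 2)) (min (η / 3) (γ / 8)) with hη₁
  have h11 : η₁ ≤ η₀ := (min_le_left _ _).trans (min_le_left _ _)
  have h12 : η₁ ≤ 1 / 2 := (min_le_left _ _).trans (min_le_right _ _)
  have h13 : η₁ ≤ η / 3 := (min_le_right _ _).trans (min_le_left _ _)
  have h14 : η₁ ≤ γ / 8 := (min_le_right _ _).trans (min_le_right _ _)
  refine ⟨max M (q + 1), η₁, c₀, γ / 4, by positivity, by positivity, ?_⟩
  rintro w' hw' c hcc₀ x' hx' δ hδ
  have hc0 : 0 ≤ c := hc₀.trans hcc₀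
  obtain ⟨hA, hV⟩ := hbound _ (Cadlag.map_fst_mem_skorokhodNhd
    (Cadlag.skorokhodNhd_mono w (le_max_left _ _) h11 hw')) c hc0 x' hx'
  obtain ⟨lam, h1, h2⟩ := hw'
  have hpart := (ht.comp lam (y := w') (η' := η₁) fun s hs =>
    h2 s (hs.trans (htr.le.trans (le_max_right _ _)))).mono (η' := η) (by linarith)
  have hlamr := NNReal.le_add_of_dist_le (h1 (t r))
  rw [htr] at hlamr
  push_cast at hlamr
  have hqlam : q < lam (t r) := by
    rw [htr]
    have : (q : ℝ) < lam (q + 1) := by linarith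
    exact_mod_cast this
  have hlamq : lam (t r) ≤ q + 2 := by
    rw [htr]
    have : (lam (q + 1) : ℝ) ≤ q + 2 := by linarith
    exact_mod_cast this
  refine iSup_le fun s => iSup_le fun u => iSup_le fun v => iSup_le fun ⟨hsu, huv, hvq, hvs⟩ => ?_
  obtain ⟨i, hi, hi1, hi2⟩ := hpart.exists_mem ((huv.trans_le hvq).trans hqlam)
  rcases lt_or_ge v (lam (t (i + 1))) with hv | hv
  · refine (min_le_right _ _).trans ?_
    rw [edist_dist]
    refine ENNReal.ofReal_le_ofReal ?_
    have h3 := hpart.snd.dist_le i hi u hi1 hi2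
    have h4 := hpart.snd.dist_le i hi v (hi1.trans huv.le) hv
    exact (dist_triangle_right _ _ _).trans (by linarith)
  · refine (min_le_left _ _).trans ?_
    rw [edist_dist]
    refine ENNReal.ofReal_le_ofReal ?_
    -- `s` and `u` both lie at distance at least `γ / 4` from the start of the piece
    have h3 := NNReal.le_add_of_dist_le (h1 (t i))
    have h4 := NNReal.le_add_of_dist_le (h1 (t (i + 1)))
    have h5 := hgap i hi
    have hv' : (lam (t (i + 1)) : ℝ) ≤ v := hv
    have hs1 : (lam (t i) : ℝ) + γ / 4 ≤ s := by linarith [h3.1, h4.2]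
    have key : ∀ u', s ≤ u' → u' < lam (t (i + 1)) →
        ‖x' u' - proj D (x' (lam (t i)))‖ ≤ ε / 4 + ε / 8 := fun u' h6 h7 => by
      have hsu' : (s : ℝ) ≤ u' := h6
      have h8 : lam (t i) ≤ u' := by
        have : (lam (t i) : ℝ) ≤ u' := by linarith
        exact_mod_cast this
      have hvle : lam (t (i + 1)) ≤ q + 2 := (hpart.monotone hi le_rfl).trans hlamq
      have h9 := hx'.norm_sub_proj_start_le hc hne hc0 (s := lam (t i)) (v := lam (t (i + 1)))
        (η := η) (V := C) (A := C)
        (fun u h1 h2 => by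
          rw [← dist_eq_norm]
          exact hpart.fst.dist_le i hi u h1 h2)
        (hV _ _ (hpart.lt_succ i hi).le hvle)
        (hA _ ((hpart.lt_succ i hi).le.trans hvle)) h8 h7.le hη.le h7
      have h10 : Real.exp (-(c * ((u' : ℝ) - lam (t i)))) * C ≤ ε / 8 := by
        refine le_trans ?_ (hexp c hcc₀)
        gcongr
        linarith
      linarith
    have h6 := key s le_rfl (hsu.trans hi2)
    have h7 := key u hsu.le hi2
    rw [dist_eq_norm, ← sub_sub_sub_cancel_right _ _ (proj D (x' (lam (t i))))]
    exact (norm_sub_le _ _).trans (by linarith)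

end Oscillation

/-! ### Solutions of the Skorokhod problem -/

section Skorokhod

variable {d : ℕ} {D : Set (EuclideanSpace ℝ (Fin d))}
  {y x k : Cadlag (EuclideanSpace ℝ (Fin d))}

/-- The reflection term of a solution of the Skorokhod problem as the integral of a unit inward
normal field `n` with respect to a locally finite measure `μ`. -/
structure IsReflection (D : Set (EuclideanSpace ℝ (Fin d)))
    (x k : Cadlag (EuclideanSpace ℝ (Fin d))) (μ : Measure ℝ≥0)
    (n : ℝ≥0 → EuclideanSpace ℝ (Fin d)) : Prop where
  lt_top : ∀ t, μ (Iic t) < ∞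
  normal : ∀ t, ∀ᵐ s ∂(μ.restrict (Iic t)), n s ∈ inwardNormals D (x s)
  integrableOn : ∀ t, IntegrableOn n (Iic t) μ
  eq_integral : ∀ t, k t = ∫ s in Iic t, n s ∂μ

theorem IsSkorokhodSolution.exists_isReflection (h : IsSkorokhodSolution D y x k) :
    ∃ μ n, IsReflection D x k μ n := by
  obtain ⟨μ, hμ, ⟨n, hn, hnormal, hk⟩, hfront⟩ := h.reflection
  have hlt : ∀ t, μ (Iic t) < ∞ := fun t => by
    rw [hμ t, lt_top_iff_ne_top]
    have := h.locallyBoundedVariation 0 t (mem_univ _) (mem_univ _)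
    rwa [univ_inter, ← bot_eq_zero', Icc_bot] at this
  have hae : ∀ t, ∀ᵐ s ∂(μ.restrict (Iic t)), n s ∈ inwardNormals D (x s) := fun t => by
    have hmeas : MeasurableSet {s | x s ∈ frontier D} :=
      x.measurable_toFun isClosed_frontier.measurableSet
    rw [ae_restrict_iff' measurableSet_Iic]
    have h0 : μ (Iic t \ {s | x s ∈ frontier D}) = 0 := by
      rw [← sdiff_self_inter, measure_sdiff inter_subset_left
        (measurableSet_Iic.inter hmeas).nullMeasurableSet
        ((measure_mono inter_subset_left).trans_lt (hlt t)).ne, ← hfront t, hμ t, tsub_self]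
    refine (measure_eq_zero_iff_ae_notMem.1 h0).mono fun s hs hst => hnormal s ?_
    by_contra hx
    exact hs ⟨hst, hx⟩
  refine ⟨μ, n, hlt, hae, fun t => ?_, hk⟩
  have : IsFiniteMeasure (μ.restrict (Iic t)) := ⟨by simpa using hlt t⟩
  exact Integrable.of_bound hn.restrict 1 ((hae t).mono fun s hs => hs.1.le)

namespace IsReflection

variable {μ : Measure ℝ≥0} {n : ℝ≥0 → EuclideanSpace ℝ (Fin d)}

theorem measure_ne_top_of_subset (h : IsReflection D x k μ n) {A : Set ℝ≥0} {t : ℝ≥0}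
    (hA : A ⊆ Iic t) : μ A ≠ ∞ :=
  ((measure_mono hA).trans_lt (h.lt_top t)).ne

theorem norm_setIntegral_le (h : IsReflection D x k μ n) {A : Set ℝ≥0} {t : ℝ≥0}
    (hA : A ⊆ Iic t) : ‖∫ s in A, n s ∂μ‖ ≤ μ.real A := by
  have := norm_setIntegral_le_of_norm_le_const_ae (μ := μ) (s := A) (f := n) (C := 1)
    (lt_top_iff_ne_top.2 (h.measure_ne_top_of_subset hA))
    ((ae_restrict_of_ae_restrict_of_subset hA (h.normal t)).mono fun s hs => hs.1.le)
  simpa using this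

/-- The increments of `k` have almost nonnegative product with `p - ξ`, for `p` in the closed
domain, over a set of times at which `x` is close to `ξ`. -/
theorem neg_inner_setIntegral_le (h : IsReflection D x k μ n) {A : Set ℝ≥0} {t : ℝ≥0}
    (hA : A ⊆ Iic t) (hAm : MeasurableSet A) {p ξ : EuclideanSpace ℝ (Fin d)}
    (hp : p ∈ closure D) {ε : ℝ} (hξ : ∀ s ∈ A, ‖x s - ξ‖ ≤ ε) :
    -(inner ℝ (p - ξ) (∫ s in A, n s ∂μ)) ≤ ε * μ.real A := by
  have hi : IntegrableOn n A μ := (h.integrableOn t).mono_set hA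
  have hfin : μ A ≠ ∞ := h.measure_ne_top_of_subset hA
  rw [← integral_inner hi]
  have h1 : ∫ _ in A, -ε ∂μ ≤ ∫ s in A, inner ℝ (p - ξ) (n s) ∂μ := by
    refine integral_mono_ae (integrableOn_const hfin) (hi.const_inner _) ?_
    filter_upwards [ae_restrict_of_ae_restrict_of_subset hA (h.normal t),
      ae_restrict_mem hAm] with s hs hsA
    have e : p - ξ = (p - x s) + (x s - ξ) := by abel
    have h2 := hs.2 p hp
    have h3 := abs_le.1 (abs_real_inner_le_norm (x s - ξ) (n s))
    rw [hs.1, mul_one] at h3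
    rw [e, inner_add_left]
    linarith [h3.1, hξ s hsA]
  rw [setIntegral_const, smul_eq_mul] at h1
  linarith

theorem setIntegral_Iio_eq_add_Ico (h : IsReflection D x k μ n) {s t : ℝ≥0} (hst : s ≤ t) :
    ∫ u in Iio t, n u ∂μ = (∫ u in Iio s, n u ∂μ) + ∫ u in Ico s t, n u ∂μ := by
  rw [← Iio_union_Ico_eq_Iio hst, setIntegral_union (Iio_disjoint_Ici le_rfl |>.mono_right
    Ico_subset_Ici_self) measurableSet_Ico]
  · exact (h.integrableOn t).mono_set fun u hu => (le_of_lt hu).trans hst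
  · exact (h.integrableOn t).mono_set fun u hu => hu.2.le

theorem tendsto_left (h : IsReflection D x k μ n) {t : ℝ≥0} (ht : 0 < t) :
    Tendsto k (𝓝[<] t) (𝓝 (∫ u in Iio t, n u ∂μ)) := by
  obtain ⟨l, hl⟩ := k.left_limits t
  obtain ⟨s, hmono, hs, hlim⟩ := exists_seq_strictMono_tendsto' ht
  have hunion : ⋃ j, Iic (s j) = Iio t := by
    ext u
    simp only [mem_iUnion, mem_Iic, mem_Iio]
    constructor
    · rintro ⟨j, hj⟩
      exact hj.trans_lt (hs j).2
    · intro hu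
      obtain ⟨j, hj⟩ := (hlim.eventually_const_lt hu).exists
      exact ⟨j, hj.le⟩
  have h1 := tendsto_setIntegral_of_monotone (μ := μ) (f := n) (s := fun j => Iic (s j))
    (fun j => measurableSet_Iic) (fun i j hij => Iic_subset_Iic.2 (hmono.monotone hij))
    (by rw [hunion]; exact (h.integrableOn t).mono_set Iio_subset_Iic_self)
  rw [hunion] at h1
  have h2 : Tendsto s atTop (𝓝[<] t) :=
    tendsto_nhdsWithin_iff.2 ⟨hlim, Eventually.of_forall fun j => (hs j).2⟩
  have h3 := hl.comp h2
  have e : (k ∘ s) = fun j => ∫ u in Iic (s j), n u ∂μ := funext fun j => h.eq_integral _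
  rw [e] at h3
  rwa [tendsto_nhds_unique h1 h3]

theorem norm_setIntegral_Iio_sub_le (h : IsReflection D x k μ n) {s t : ℝ≥0} (hst : s < t)
    {v : EuclideanSpace ℝ (Fin d)} {ε : ℝ} (hk : ∀ u, s ≤ u → u < t → ‖k u - v‖ ≤ ε) :
    ‖(∫ u in Iio t, n u ∂μ) - v‖ ≤ ε := by
  have : (𝓝[<] t).NeBot := nhdsLT_neBot_of_exists_lt ⟨s, hst⟩
  refine le_of_tendsto (((h.tendsto_left (zero_le.trans_lt hst)).sub_const v).norm) ?_
  filter_upwards [Ioo_mem_nhdsLT hst] with u hu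
  exact hk u hu.1.le hu.2

end IsReflection

/-- A solution of the Skorokhod problem is continuous wherever its data is: a jump of `k` points
into the domain, whereas its starting point `x_{t-}` already lies in the closed domain. -/
theorem IsSkorokhodSolution.continuousAt (h : IsSkorokhodSolution D y x k) {t : ℝ≥0}
    (ht : y.jump t = 0) : ContinuousAt y t ∧ ContinuousAt x t := by
  have hcont : ∀ z : Cadlag (EuclideanSpace ℝ (Fin d)),
      Tendsto z (𝓝[<] t) (𝓝 (z t)) → ContinuousAt z t := fun z hz =>
    continuousAt_iff_continuous_left'_right'.2
      ⟨hz, (z.right_continuous t).mono Ioi_subset_Ici_self⟩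
  have hy : Tendsto y (𝓝[<] t) (𝓝 (y t)) := by
    have h1 := tendsto_leftLim_of_tendsto (y.left_limits t)
    rwa [← sub_eq_zero.1 ht] at h1
  refine ⟨hcont y hy, hcont x ?_⟩
  rcases eq_or_lt_of_le (zero_le (a := t)) with rfl | hpos
  · have e : Iio (0 : ℝ≥0) = ∅ := by ext; simp
    rw [e, nhdsWithin_empty]
    exact tendsto_bot
  obtain ⟨μ, n, hr⟩ := h.exists_isReflection
  have : (𝓝[<] t).NeBot := nhdsLT_neBot_of_exists_lt ⟨0, hpos⟩
  have hlim : Tendsto x (𝓝[<] t) (𝓝 (y t + ∫ u in Iio t, n u ∂μ)) := by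
    have e : (x : ℝ≥0 → _) = fun u => y u + k u := funext h.eq_add
    rw [e]
    exact hy.add (hr.tendsto_left hpos)
  set l := y t + ∫ u in Iio t, n u ∂μ with hl
  have hlD : l ∈ closure D :=
    isClosed_closure.mem_of_tendsto hlim (Eventually.of_forall h.mem_closure)
  have hjump : x t - l = μ.real {t} • n t := by
    rw [h.eq_add, hr.eq_integral, hl, ← Iio_union_right, setIntegral_union (by simp)
      (measurableSet_singleton t) ((hr.integrableOn t).mono_set Iio_subset_Iic_self)
      ((hr.integrableOn t).mono_set (by simp)), integral_singleton]
    abel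
  suffices h0 : μ.real {t} = 0 by
    rw [h0, zero_smul, sub_eq_zero] at hjump
    rwa [hjump]
  by_contra h0
  have hn : n t ∈ inwardNormals D (x t) := by
    by_contra hn
    refine h0 ?_
    rw [measureReal_def, ENNReal.toReal_eq_zero_iff]
    left
    have := measure_eq_zero_iff_ae_notMem.2 ((hr.normal t).mono fun s hs =>
      show s ∉ ({t} : Set ℝ≥0) from fun hst => hn (hst ▸ hs))
    rwa [Measure.restrict_apply (measurableSet_singleton t),
      inter_eq_left.2 (by simp)] at this
  have h1 := hn.2 l hlD
  have e : l - x t = -(μ.real {t} • n t) := by rw [← hjump]; abel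
  rw [e, inner_neg_left, real_inner_smul_left, real_inner_self_eq_norm_mul_norm, hn.1] at h1
  exact h0 (le_antisymm (by linarith) measureReal_nonneg)

end Skorokhod

/-! ### Comparison of penalized paths with the reflected path -/

section Comparison

/-- One step of the comparison: the squared distance of two accumulated reflection terms grows
little when their increments `b` and `a` pair with the current distance with the right signs. -/
theorem norm_sq_le_of_increment {E : Type*} [NormedAddCommGroup E] [InnerProductSpace ℝ E]
    {g g' a b ζ : E} {ε Va Vb : ℝ} (hg : g' = g + b - a) (hζ : ‖g' - ζ‖ ≤ ε)
    (ha : ‖a‖ ≤ Va) (hb : ‖b‖ ≤ Vb) (hζb : inner ℝ ζ b ≤ ε * Vb) (hζa : -(inner ℝ ζ a) ≤ ε * Va) :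
    ‖g'‖ ^ 2 ≤ ‖g‖ ^ 2 + 4 * ε * (Vb + Va) := by
  have hε : 0 ≤ ε := (norm_nonneg _).trans hζ
  have e : g = g' - (b - a) := by rw [hg]; abel
  have h1 := norm_sub_sq_real g' (b - a)
  rw [← e] at h1
  have e2 : inner ℝ g' (b - a)
      = inner ℝ ζ b + -(inner ℝ ζ a) + inner ℝ (g' - ζ) (b - a) := by
    simp only [inner_sub_left, inner_sub_right]; ring
  have h2 := (real_inner_le_norm (g' - ζ) (b - a)).trans
    (mul_le_mul hζ ((norm_sub_le b a).trans (add_le_add hb ha)) (norm_nonneg _) hε)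
  nlinarith [sq_nonneg ‖b - a‖]

theorem inner_neg_integral_penalty_le {E : Type*} [NormedAddCommGroup E] [InnerProductSpace ℝ E]
    [FiniteDimensional ℝ E] [MeasurableSpace E] [BorelSpace E] {D : Set E} (hc : Convex ℝ D)
    (hne : D.Nonempty) {c : ℝ} (hc0 : 0 ≤ c) (x : Cadlag E) {s v : ℝ≥0} (hsv : s ≤ v)
    {p ξ : E} (hξ : ξ ∈ closure D) {ε : ℝ}
    (hp : ∀ u, s ≤ u → u < v → ‖proj D (x u) - p‖ ≤ ε) :
    inner ℝ (p - ξ) (-(c • ∫ τ in (s : ℝ)..v, penalty D x τ))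
      ≤ ε * (c * ∫ τ in (s : ℝ)..v, ‖penalty D x τ‖) := by
  have hsv' : (s : ℝ) ≤ v := hsv
  have hi := intervalIntegrable_penalty hc hne x s v
  have h1 : ∫ τ in (s : ℝ)..v, -ε * ‖penalty D x τ‖
      ≤ ∫ τ in (s : ℝ)..v, inner ℝ (p - ξ) (penalty D x τ) := by
    refine intervalIntegral.integral_mono_on_of_le_Ioo hsv' (hi.norm.const_mul _)
      ⟨hi.1.const_inner _, hi.2.const_inner _⟩ ?_
    intro τ hτ
    lift τ to ℝ≥0 using s.coe_nonneg.trans hτ.1.le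
    have e3 : penalty D x τ = x τ - proj D (x τ) := by simp [penalty]
    rw [e3]
    have h2 := proj_inner_le hc hne (x τ) ξ hξ
    have h3 := abs_le.1 (abs_real_inner_le_norm (proj D (x τ) - p) (x τ - proj D (x τ)))
    have h4 := mul_le_mul_of_nonneg_right (hp τ hτ.1.le hτ.2) (norm_nonneg (x τ - proj D (x τ)))
    have e : p - ξ = -(ξ - proj D (x τ)) - (proj D (x τ) - p) := by abel
    rw [e, inner_sub_left, inner_neg_left, real_inner_comm]
    linarith [h3.2]
  have h5 : ∫ τ in (s : ℝ)..v, inner ℝ (p - ξ) (penalty D x τ)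
      = inner ℝ (p - ξ) (∫ τ in (s : ℝ)..v, penalty D x τ) := by
    rw [intervalIntegral.integral_of_le hsv', intervalIntegral.integral_of_le hsv']
    exact integral_inner hi.1 _
  rw [intervalIntegral.integral_const_mul, h5] at h1
  rw [inner_neg_right, real_inner_smul_right]
  nlinarith

variable {d : ℕ} {D : Set (EuclideanSpace ℝ (Fin d))}
  {y x k : Cadlag (EuclideanSpace ℝ (Fin d))}

/-- The deterministic core: if `(y', w')` is `J₁`-close to `(y, w)` and the penalization parameter
is large, then `(Π(x'), w')` is `J₁`-close to `(x, w)`.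

The same time change serves for both. On a partition `t` with small oscillation of `x` and `y`, and
its image under the time change, the difference of the two reflection terms just before the end of a
piece is nearly `Π(x')` at the start of the piece minus `x` there, because the penalized path has
settled by then; `norm_sq_le_of_increment` then bounds its growth over the piece. -/
theorem exists_proj_mem_skorokhodNhd (hopen : IsOpen D) (hc : Convex ℝ D) (hne : D.Nonempty)
    (h : IsSkorokhodSolution D y x k) {F : Type*} [PseudoMetricSpace F] (w : Cadlag F)
    (N : ℝ≥0) {ε : ℝ} (hε : 0 < ε) :
    ∃ M : ℝ≥0, ∃ η c₀ : ℝ, 0 < η ∧ ∀ w' ∈ (y.prodMk w).skorokhodNhd M η, ∀ c ≥ c₀, ∀ x',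
      PenalizedEq D c (w'.map Prod.fst continuous_fst) x' →
        (x'.map (proj D) (continuous_proj hc hne)).prodMk (w'.map Prod.snd continuous_snd)
          ∈ (x.prodMk w).skorokhodNhd N ε := by
  obtain ⟨μ, n, hr⟩ := h.exists_isReflection
  obtain ⟨M, η₀, C, hη₀, hC, hbound⟩ := exists_uniform_bound hopen hc hne y (N + 2)
  set V := μ.real (Iic (N + 1)) with hV
  have hV0 : 0 ≤ V := measureReal_nonneg
  -- `κ` bounds the errors on a piece, `η` the oscillations
  obtain ⟨κ, hκ, hκle⟩ := exists_pos_add_sqrt_le (4 * (C + V)) (show 0 < ε / 4 by positivity)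
  obtain ⟨η, hη, hηle⟩ := exists_pos_add_sqrt_le (C + C) (show 0 < κ / 4 by positivity)
  have hηκ : η ≤ κ / 4 := (le_add_of_nonneg_right (Real.sqrt_nonneg _)).trans hηle
  have hκε : κ ≤ ε / 4 := (le_add_of_nonneg_right (Real.sqrt_nonneg _)).trans hκle
  obtain ⟨r, t, ht, htr⟩ := (x.prodMk y).exists_isPartition (show 0 < η / 3 by positivity) (N + 1)
  have htx : x.IsPartition (η / 3) r t := ht.fst
  have hty : y.IsPartition (η / 3) r t := ht.snd
  obtain ⟨γ, hγ, hgap⟩ := ht.exists_gap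
  obtain ⟨c₀, hc₀, hexp⟩ := exists_exp_mul_le (show 0 < γ / 2 by positivity) C
    (show 0 < κ / 4 by positivity)
  set η₁ := min (min η₀ (1 / 2)) (min (η / 3) (γ / 4)) with hη₁
  have h11 : η₁ ≤ η₀ := (min_le_left _ _).trans (min_le_left _ _)
  have h12 : η₁ ≤ 1 / 2 := (min_le_left _ _).trans (min_le_right _ _)
  have h13 : η₁ ≤ η / 3 := (min_le_right _ _).trans (min_le_left _ _)
  have h14 : η₁ ≤ γ / 4 := (min_le_right _ _).trans (min_le_right _ _)
  refine ⟨max M (N + 1), η₁, c₀, by positivity, ?_⟩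
  rintro w' hw' c hcc₀ x' hx'
  have hc0 : 0 ≤ c := hc₀.trans hcc₀
  obtain ⟨hA, hVar⟩ := hbound _ (Cadlag.map_fst_mem_skorokhodNhd_of_prodMk
    (Cadlag.skorokhodNhd_mono _ (le_max_left _ _) h11 hw')) c hc0 x' hx'
  obtain ⟨lam, h1, h2⟩ := hw'
  set y' := w'.map Prod.fst continuous_fst with hy'
  have h2' : ∀ s ≤ t r, dist (w' (lam s)) ((y.prodMk w) s) ≤ η₁ := fun s hs =>
    h2 s (hs.trans (htr.le.trans (le_max_right _ _)))
  have h2y : ∀ s ≤ t r, ‖y' (lam s) - y s‖ ≤ η₁ := fun s hs => by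
    rw [← dist_eq_norm]
    exact (le_max_left _ _).trans (h2' s hs)
  have hpart : y'.IsPartition η r fun i => lam (t i) :=
    (hty.comp lam (y := y') (η' := η₁) fun s hs => (le_max_left _ _).trans (h2' s hs)).mono
      (by linarith)
  have hlamr : ∀ i ≤ r, lam (t i) ≤ N + 2 := fun i hi => by
    have h3 := (NNReal.le_add_of_dist_le (h1 (t r))).1
    rw [htr] at h3
    push_cast at h3
    have h4 : lam (t i) ≤ lam (t r) := lam.monotone (ht.monotone hi le_rfl)
    rw [htr] at h4
    have : (lam (N + 1) : ℝ) ≤ N + 2 := by linarith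
    exact h4.trans (by exact_mod_cast this)
  set τ : ℕ → ℝ≥0 := fun i => lam (t i) with hτ
  have hτlt : ∀ i < r, τ i < τ (i + 1) := hpart.lt_succ
  have hpiece : ∀ i < r, ∀ u, τ i ≤ u → u < τ (i + 1) → ‖y' u - y' (τ i)‖ ≤ η := fun i hi u h3 h4 => by
    rw [← dist_eq_norm]
    exact hpart.dist_le i hi u h3 h4
  have hproj : ∀ i < r, ∀ u, τ i ≤ u → u < τ (i + 1) →
      ‖proj D (x' u) - proj D (x' (τ i))‖ ≤ κ / 4 := fun i hi u h3 h4 =>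
    (hx'.norm_proj_sub_proj_start_le hc hne hc0 (hpiece i hi)
      (hVar _ _ (hτlt i hi).le (hlamr _ hi)) (hA _ (hlamr i hi.le)) h3 h4.le hη.le h4).trans hηle
  have hxpiece : ∀ i < r, ∀ u, t i ≤ u → u < t (i + 1) → ‖x u - x (t i)‖ ≤ η := fun i hi u h3 h4 => by
    rw [← dist_eq_norm]
    exact (htx.dist_le i hi u h3 h4).trans (by linarith)
  -- `g i` is the difference of the reflection terms just before the `i`-th point
  set g : ℕ → EuclideanSpace ℝ (Fin d) := fun i =>
    -(c • ∫ s in (0 : ℝ)..τ i, penalty D x' s) - ∫ u in Iio (t i), n u ∂μ with hg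
  have hgnear : ∀ i < r, ‖g (i + 1) - (proj D (x' (τ i)) - x (t i))‖ ≤ 2 * κ := fun i hi => by
    have h3 := hx'.norm_primitive_sub_proj_le hc hne hc0 (hpiece i hi)
      (hVar _ _ (hτlt i hi).le (hlamr _ hi)) (hA _ (hlamr i hi.le)) (hτlt i hi).le le_rfl hη.le
    have h4 : Real.exp (-(c * ((τ (i + 1) : ℝ) - τ i))) * C ≤ κ / 4 := by
      refine le_trans ?_ (hexp c hcc₀)
      have h5 := hgap i hi
      have h6 := (NNReal.le_add_of_dist_le (h1 (t i))).1
      have h7 := (NNReal.le_add_of_dist_le (h1 (t (i + 1)))).2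
      gcongr
      simp only [hτ]
      linarith
    have h5 : ‖(∫ u in Iio (t (i + 1)), n u ∂μ) - (x (t i) - y (t i))‖ ≤ κ / 4 := by
      refine hr.norm_setIntegral_Iio_sub_le (ht.lt_succ i hi) fun u h6 h7 => ?_
      have h8 := htx.dist_le i hi u h6 h7
      have h9 := hty.dist_le i hi u h6 h7
      rw [dist_eq_norm] at h8 h9
      have e : k u - (x (t i) - y (t i)) = (x u - x (t i)) - (y u - y (t i)) := by
        rw [h.eq_add u]; abel
      rw [e]
      exact (norm_sub_le _ _).trans (by linarith)
    have h6 := h2y (t i) (ht.monotone hi.le le_rfl)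
    have e2 := intervalIntegral.integral_add_adjacent_intervals
      (intervalIntegrable_penalty hc hne x' 0 (τ i))
      (intervalIntegrable_penalty hc hne x' (τ i) (τ (i + 1)))
    have e : g (i + 1) - (proj D (x' (τ i)) - x (t i))
        = ((x' (τ i) - c • ∫ s in (τ i : ℝ)..τ (i + 1), penalty D x' s) - proj D (x' (τ i)))
          - ((∫ u in Iio (t (i + 1)), n u ∂μ) - (x (t i) - y (t i))) - (y' (τ i) - y (t i)) := by
      simp only [hg]
      rw [← e2, hx' (τ i), smul_add]
      abel
    rw [e]
    refine (norm_sub_le _ _).trans ((add_le_add_left (norm_sub_le _ _) _).trans ?_)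
    have h7 := Real.sqrt_nonneg (2 * η * (C + C))
    linarith
  have hgsq : ∀ i ≤ r, ‖g i‖ ^ 2 ≤ 4 * (2 * κ) *
      (c * (∫ s in (0 : ℝ)..τ i, ‖penalty D x' s‖) + μ.real (Iio (t i))) := fun i hi => by
    induction i with
    | zero =>
      have e1 : t 0 = 0 := ht.zero
      have e2 : τ 0 = 0 := hpart.zero
      simp [hg, e1, e2]
    | succ i ih =>
      have hi' : i < r := hi
      have hlt := ht.lt_succ i hi'
      have hpen := intervalIntegrable_penalty hc hne x'
      have e2 := intervalIntegral.integral_add_adjacent_intervals (hpen 0 (τ i))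
        (hpen (τ i) (τ (i + 1)))
      have e3 := intervalIntegral.integral_add_adjacent_intervals (hpen 0 (τ i)).norm
        (hpen (τ i) (τ (i + 1))).norm
      have hsub : Ico (t i) (t (i + 1)) ⊆ Iic (N + 1) := fun u hu =>
        hu.2.le.trans ((ht.monotone hi le_rfl).trans htr.le)
      have e4 : μ.real (Iio (t (i + 1))) = μ.real (Iio (t i)) + μ.real (Ico (t i) (t (i + 1))) := by
        rw [← Iio_union_Ico_eq_Iio hlt.le, measureReal_union (Iio_disjoint_Ici le_rfl |>.mono_right
          Ico_subset_Ici_self) measurableSet_Ico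
          (hr.measure_ne_top_of_subset (t := t i) Iio_subset_Iic_self)
          (hr.measure_ne_top_of_subset hsub)]
      have hstep := norm_sq_le_of_increment (g := g i) (g' := g (i + 1))
        (a := ∫ u in Ico (t i) (t (i + 1)), n u ∂μ)
        (b := -(c • ∫ s in (τ i : ℝ)..τ (i + 1), penalty D x' s))
        (ζ := proj D (x' (τ i)) - x (t i)) (ε := 2 * κ)
        (Va := μ.real (Ico (t i) (t (i + 1))))
        (Vb := c * ∫ s in (τ i : ℝ)..τ (i + 1), ‖penalty D x' s‖)
        (by
          simp only [hg]
          rw [hr.setIntegral_Iio_eq_add_Ico hlt.le, ← e2, smul_add]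
          abel)
        (hgnear i hi') (hr.norm_setIntegral_le hsub)
        (by
          rw [norm_neg, norm_smul, Real.norm_of_nonneg hc0]
          exact mul_le_mul_of_nonneg_left
            (intervalIntegral.norm_integral_le_integral_norm (hτlt i hi').le) hc0)
        (inner_neg_integral_penalty_le hc hne hc0 x' (hτlt i hi').le (h.mem_closure _)
          fun u h3 h4 => (hproj i hi' u h3 h4).trans (by linarith))
        (hr.neg_inner_setIntegral_le hsub measurableSet_Ico (proj_mem hne _) fun u hu =>
          (hxpiece i hi' u hu.1 hu.2).trans (by linarith))
      have := ih hi'.le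
      rw [← e3, e4]
      linarith
  have hgle : ∀ i < r, ‖g (i + 1)‖ ≤ √(2 * κ * (4 * (C + V))) := fun i hi => by
    refine Real.le_sqrt_of_sq_le ((hgsq (i + 1) hi).trans ?_)
    have h3 := hVar 0 (τ (i + 1)) zero_le (hlamr _ hi)
    rw [NNReal.coe_zero] at h3
    have h4 : μ.real (Iio (t (i + 1))) ≤ V :=
      measureReal_mono (fun u hu => (le_of_lt hu).trans ((ht.monotone hi le_rfl).trans htr.le))
        (hr.lt_top _).ne
    have : 4 * (2 * κ) * (c * (∫ s in (0 : ℝ)..τ (i + 1), ‖penalty D x' s‖)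
        + μ.real (Iio (t (i + 1)))) ≤ 4 * (2 * κ) * (C + V) := by gcongr
    linarith
  refine ⟨lam, fun s => (h1 s).trans (by linarith), fun u hu => ?_⟩
  have hur : u < t r := by
    rw [htr]
    exact lt_of_le_of_lt hu (by simp)
  refine max_le ?_ ((le_max_right _ _).trans ((h2' u hur.le).trans (by linarith)))
  obtain ⟨i, hi, hi1, hi2⟩ := ht.exists_mem hur
  change dist (proj D (x' (lam u))) (x u) ≤ ε
  have h3 := hproj i hi (lam u) (lam.monotone hi1) (lam.strictMono hi2)
  have h4 := hxpiece i hi u hi1 hi2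
  have h5 := norm_le_insert' (proj D (x' (τ i)) - x (t i)) (g (i + 1))
  rw [norm_sub_rev _ (g (i + 1))] at h5
  have e : proj D (x' (lam u)) - x u = (proj D (x' (lam u)) - proj D (x' (τ i)))
      + (proj D (x' (τ i)) - x (t i)) - (x u - x (t i)) := by abel
  rw [dist_eq_norm, e]
  refine (norm_sub_le _ _).trans ((add_le_add_left (norm_add_le _ _) _).trans ?_)
  have h6 := hgnear i hi
  have h7 := hgle i hi
  linarith

/-- At a time where the data does not jump, the penalized paths themselves converge: there is no
relaxation layer. -/
theorem exists_dist_eval_le (hopen : IsOpen D) (hc : Convex ℝ D) (hne : D.Nonempty)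
    (h : IsSkorokhodSolution D y x k) {F : Type*} [PseudoMetricSpace F] (w : Cadlag F)
    {t : ℝ≥0} (ht : y.jump t = 0) {ε : ℝ} (hε : 0 < ε) :
    ∃ M : ℝ≥0, ∃ η c₀ : ℝ, 0 < η ∧ ∀ w' ∈ (y.prodMk w).skorokhodNhd M η, ∀ c ≥ c₀, ∀ x',
      PenalizedEq D c (w'.map Prod.fst continuous_fst) x' → dist (x' t) (x t) ≤ ε := by
  rcases eq_or_lt_of_le (zero_le (a := t)) with rfl | hpos
  · refine ⟨0, ε, 0, hε, ?_⟩
    rintro w' ⟨lam, -, h2⟩ c - x' hx'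
    have h3 := (le_max_left _ _).trans (h2 0 le_rfl)
    have e : lam 0 = 0 := map_bot lam
    rw [e] at h3
    have e2 : x 0 = y 0 := by rw [h.eq_add, h.zero, add_zero]
    rw [e2, hx'.zero]
    exact h3
  obtain ⟨hyc, hxc⟩ := h.continuousAt ht
  obtain ⟨M, η₀, C, hη₀, hC, hbound⟩ := exists_uniform_bound hopen hc hne y (t + 1)
  obtain ⟨η, hη, hηle⟩ := exists_pos_add_sqrt_le (C + C) (show 0 < ε / 8 by positivity)
  have hηε : η ≤ ε / 8 := (le_add_of_nonneg_right (Real.sqrt_nonneg _)).trans hηle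
  obtain ⟨κ₁, hκ₁, hnear₁⟩ := Metric.continuousAt_iff.1 hyc (η / 4) (by positivity)
  obtain ⟨κ₂, hκ₂, hnear₂⟩ := Metric.continuousAt_iff.1 hxc (η / 4) (by positivity)
  have hpos' : (0 : ℝ) < t := hpos
  set κ := min (min κ₁ κ₂) (min (t : ℝ) 1) with hκdef
  have hκ : 0 < κ := lt_min (lt_min hκ₁ hκ₂) (lt_min hpos' one_pos)
  have hκ1 : κ ≤ κ₁ := (min_le_left _ _).trans (min_le_left _ _)
  have hκ2 : κ ≤ κ₂ := (min_le_left _ _).trans (min_le_right _ _)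
  have hκt : κ ≤ t := (min_le_right _ _).trans (min_le_left _ _)
  have hκ3 : κ ≤ 1 := (min_le_right _ _).trans (min_le_right _ _)
  obtain ⟨M₂, η₂, c₂, hη₂, hconv⟩ := exists_proj_mem_skorokhodNhd hopen hc hne h w (t + 1)
    (show 0 < min (ε / 8) (κ / 2) from lt_min (by positivity) (by positivity))
  obtain ⟨c₀, hc₀, hexp⟩ := exists_exp_mul_le (show 0 < κ / 2 by positivity) C
    (show 0 < ε / 8 by positivity)
  set η₁ := min (min η₀ η₂) (min (η / 4) (κ / 4)) with hη₁
  have h11 : η₁ ≤ η₀ := (min_le_left _ _).trans (min_le_left _ _)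
  have h12 : η₁ ≤ η₂ := (min_le_left _ _).trans (min_le_right _ _)
  have h13 : η₁ ≤ η / 4 := (min_le_right _ _).trans (min_le_left _ _)
  have h14 : η₁ ≤ κ / 4 := (min_le_right _ _).trans (min_le_right _ _)
  refine ⟨max (max M M₂) (t + 1), η₁, max c₀ c₂, by positivity, ?_⟩
  rintro w' hw' c hcc x' hx'
  have hcc₀ : c₀ ≤ c := (le_max_left _ _).trans hcc
  have hc0 : 0 ≤ c := hc₀.trans hcc₀
  obtain ⟨hA, hVar⟩ := hbound _ (Cadlag.map_fst_mem_skorokhodNhd_of_prodMk (Cadlag.skorokhodNhd_mono _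
    ((le_max_left _ _).trans (le_max_left _ _)) h11 hw')) c hc0 x' hx'
  obtain ⟨mu, h3, h4⟩ := hconv w' (Cadlag.skorokhodNhd_mono _
    ((le_max_right _ _).trans (le_max_left _ _)) h12 hw') c ((le_max_right _ _).trans hcc) x' hx'
  obtain ⟨lam, h1, h2⟩ := hw'
  set y' := w'.map Prod.fst continuous_fst with hy'
  -- the path starts to relax at time `s`, well before `t`
  obtain ⟨s, hs⟩ : ∃ s : ℝ≥0, (s : ℝ) = t - κ / 2 := ⟨⟨t - κ / 2, by linarith⟩, rfl⟩
  obtain ⟨v, hv⟩ : ∃ v : ℝ≥0, (v : ℝ) = t + κ / 8 := ⟨⟨t + κ / 8, by positivity⟩, rfl⟩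
  have hst : s ≤ t := by
    have : (s : ℝ) ≤ t := by linarith
    exact_mod_cast this
  have htv : t < v := by
    have : (t : ℝ) < v := by linarith
    exact_mod_cast this
  have hvt : v ≤ t + 1 := by
    have : (v : ℝ) ≤ t + 1 := by linarith
    exact_mod_cast this
  have hyt : ∀ u, s ≤ u → u < v → ‖y' u - y t‖ ≤ η / 2 := fun u hsu huv => by
    obtain ⟨b, rfl⟩ := lam.surjective u
    have h5 := NNReal.le_add_of_dist_le (h1 b)
    have h6 : (s : ℝ) ≤ lam b := hsu
    have h7 : (lam b : ℝ) < v := huv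
    have h8 : dist b t < κ := by
      rw [NNReal.dist_eq, abs_lt]
      constructor <;> linarith [h5.1, h5.2]
    have h9 : b ≤ t + 1 := by
      have : (b : ℝ) ≤ t + 1 := by linarith [h5.1, h5.2]
      exact_mod_cast this
    have h10 : dist (y' (lam b)) (y b) ≤ η₁ :=
      (le_max_left _ _).trans (h2 b (h9.trans (le_max_right _ _)))
    have h15 := hnear₁ (h8.trans_le hκ1)
    rw [← dist_eq_norm]
    exact (dist_triangle _ (y b) _).trans (by linarith)
  have hys : ∀ u, s ≤ u → u < v → ‖y' u - y' s‖ ≤ η := fun u hsu huv => by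
    have h5 := hyt u hsu huv
    have h6 := hyt s le_rfl (hst.trans_lt htv)
    rw [← sub_sub_sub_cancel_right _ _ (y t)]
    exact (norm_sub_le _ _).trans (by linarith)
  have hV := hVar s v (hst.trans htv.le) hvt
  have hAs := hA s (hst.trans (htv.le.trans hvt))
  have h5 := hx'.norm_sub_proj_start_le hc hne hc0 hys hV hAs hst htv.le hη.le htv
  have h6 := hx'.norm_proj_sub_proj_start_le hc hne hc0 hys hV hAs hst htv.le hη.le htv
  have h7 : Real.exp (-(c * ((t : ℝ) - s))) * C ≤ ε / 8 := by
    refine le_trans (le_of_eq ?_) (hexp c hcc₀)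
    rw [hs]
    congr 3
    ring
  obtain ⟨b, hb⟩ := mu.surjective t
  have h8 := NNReal.le_add_of_dist_le (h3 b)
  rw [hb] at h8
  have h9 := min_le_right (ε / 8) (κ / 2)
  have h10 : b ≤ t + 1 := by
    have : (b : ℝ) ≤ t + 1 := by linarith [h8.2]
    exact_mod_cast this
  have h15 : dist (proj D (x' (mu b))) (x b) ≤ min (ε / 8) (κ / 2) :=
    (le_max_left _ _).trans (h4 b h10)
  rw [hb] at h15
  have h16 : dist (x b) (x t) < η / 4 := by
    refine hnear₂ (lt_of_lt_of_le ?_ hκ2)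
    rw [NNReal.dist_eq, abs_lt]
    constructor <;> linarith [h8.1, h8.2]
  have h17 := min_le_left (ε / 8) (κ / 2)
  rw [← dist_eq_norm] at h5 h6
  have h18 := dist_triangle4 (x' t) (proj D (x' s)) (proj D (x' t)) (x t)
  have h19 := dist_triangle (proj D (x' t)) (x b) (x t)
  rw [dist_comm (proj D (x' s))] at h18
  linarith

end Comparison

/-! ### Transfer to laws -/

section Measurability

namespace Cadlag

theorem measurable_map {E F : Type*} [PseudoMetricSpace E] [MeasurableSpace E] [BorelSpace E]
    [PseudoMetricSpace F] [SecondCountableTopology F] [MeasurableSpace F] [BorelSpace F]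
    {f : E → F} (hf : Continuous f) : Measurable fun x : Cadlag E => x.map f hf :=
  measurable_of_eval fun t => hf.measurable.comp (measurable_eval t)

theorem aemeasurable_prodMk {Ω E F : Type*} [MeasurableSpace Ω] {P : Measure Ω}
    [PseudoMetricSpace E] [SecondCountableTopology E] [MeasurableSpace E] [BorelSpace E]
    [PseudoMetricSpace F] [SecondCountableTopology F] [MeasurableSpace F] [BorelSpace F]
    {f : Ω → Cadlag E} {g : Ω → Cadlag F} (hf : AEMeasurable f P) (hg : AEMeasurable g P) :
    AEMeasurable (fun ω => (f ω).prodMk (g ω)) P := by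
  refine ⟨fun ω => (hf.mk f ω).prodMk (hg.mk g ω), measurable_of_eval fun t => ?_, ?_⟩
  · exact ((measurable_eval t).comp hf.measurable_mk).prodMk
      ((measurable_eval t).comp hg.measurable_mk)
  · filter_upwards [hf.ae_eq_mk, hg.ae_eq_mk] with ω h1 h2
    rw [← h1, ← h2]

end Cadlag

end Measurability

section Laws

theorem PNat.eventually_le_cast (c : ℝ) : ∀ᶠ n : ℕ+ in atTop, c ≤ ((n : ℕ) : ℝ) := by
  filter_upwards [eventually_ge_atTop (⟨⌈c⌉₊ + 1, Nat.succ_pos _⟩ : ℕ+)] with n hn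
  have h1 : ⌈c⌉₊ + 1 ≤ (n : ℕ) := hn
  exact (Nat.le_ceil c).trans (by exact_mod_cast (by omega : ⌈c⌉₊ ≤ (n : ℕ)))

variable {d : ℕ} {D : Set (EuclideanSpace ℝ (Fin d))}

/-- The bound on the modulus holds uniformly on compact sets. -/
theorem exists_jakubowskiModulus_le_of_isCompact (hopen : IsOpen D) (hc : Convex ℝ D)
    (hne : D.Nonempty) {F : Type*} [PseudoMetricSpace F]
    {K : Set (Cadlag (EuclideanSpace ℝ (Fin d) × F))} (hK : IsCompact K) {ε : ℝ} (hε : 0 < ε)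
    (q : ℝ≥0) :
    ∃ c₀ δ₀ : ℝ, 0 < δ₀ ∧ ∀ w ∈ K, ∀ c ≥ c₀, ∀ x,
      PenalizedEq D c (w.map Prod.fst continuous_fst) x → ∀ δ ≤ δ₀,
        x.jakubowskiModulus (w.map Prod.snd continuous_snd) δ q ≤ ENNReal.ofReal ε := by
  refine hK.induction_on ?_ ?_ ?_ ?_
  · exact ⟨0, 1, one_pos, fun w hw => absurd hw (notMem_empty w)⟩
  · rintro S T hST ⟨c₀, δ₀, h0, h⟩
    exact ⟨c₀, δ₀, h0, fun w hw => h w (hST hw)⟩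
  · rintro S T ⟨c₁, δ₁, h1, h1'⟩ ⟨c₂, δ₂, h2, h2'⟩
    refine ⟨max c₁ c₂, min δ₁ δ₂, lt_min h1 h2, ?_⟩
    rintro w (hw | hw) c hcc x hx δ hδ
    · exact h1' w hw c ((le_max_left _ _).trans hcc) x hx δ (hδ.trans (min_le_left _ _))
    · exact h2' w hw c ((le_max_right _ _).trans hcc) x hx δ (hδ.trans (min_le_right _ _))
  · intro w _
    obtain ⟨M, η, c₀, δ₀, hη, hδ₀, h⟩ := exists_jakubowskiModulus_le hopen hc hne w hε q
    exact ⟨_, mem_nhdsWithin_of_mem_nhds (Cadlag.skorokhodNhd_mem_nhds w M hη), c₀, δ₀, hδ₀, h⟩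

end Laws

theorem corollary3p5 {d : ℕ} (D : Set (EuclideanSpace ℝ (Fin d)))
    (hopen : IsOpen D) (hconv : Convex ℝ D) (hne : D.Nonempty)
    {Ω : ℕ+ → Type*} [∀ n, MeasurableSpace (Ω n)]
    (P : ∀ n, Measure (Ω n)) [∀ n, IsProbabilityMeasure (P n)]
    (Y X : ∀ n, Ω n → Cadlag (EuclideanSpace ℝ (Fin d)))
    (hYmeas : ∀ n, AEMeasurable (Y n) (P n)) (hXmeas : ∀ n, AEMeasurable (X n) (P n))
    (hY0 : ∀ n, ∀ᵐ ω ∂(P n), Y n ω 0 ∈ closure D)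
    (hX : ∀ n : ℕ+, ∀ᵐ ω ∂(P n), IsPenalizedSolution D ((n : ℕ) : ℝ) (Y n ω) (X n ω)) :
    -- (i)
    (∀ Z : ∀ n, Ω n → Cadlag (EuclideanSpace ℝ (Fin d)),
      IsTightSequence P (fun n ω => (Y n ω).prodMk (Z n ω)) →
      ∀ ε : ℝ, 0 < ε → ∀ q : ℝ≥0,
        Tendsto (fun δ : ℝ =>
            limsup (fun n => P n {ω | ENNReal.ofReal ε <
              (X n ω).jakubowskiModulus (Z n ω) δ q}) atTop)
          (𝓝[>] 0) (𝓝 0)) ∧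
    -- (ii)
    (∀ (H Z : ∀ n, Ω n → Cadlag (EuclideanSpace ℝ (Fin d)))
      {Ω' : Type*} [MeasurableSpace Ω'] (P' : Measure Ω') [IsProbabilityMeasure P']
      (Y' H' Z' X' K' : Ω' → Cadlag (EuclideanSpace ℝ (Fin d))),
      AEMeasurable X' P' →
      (∀ᵐ ω ∂P', IsSkorokhodSolution D (Y' ω) (X' ω) (K' ω)) →
      ConvergesInLaw P P' (fun n ω => (Y n ω).prodMk ((H n ω).prodMk (Z n ω)))
        (fun ω => (Y' ω).prodMk ((H' ω).prodMk (Z' ω))) →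
      ConvergesInLaw P P'
          (fun n ω => ((X n ω).map (proj D) (continuous_proj hconv hne)).prodMk
            ((H n ω).prodMk (Z n ω)))
          (fun ω => (X' ω).prodMk ((H' ω).prodMk (Z' ω))) ∧
        ∀ (m : ℕ) (t : Fin m → ℝ≥0),
          (∀ i, ∀ᵐ ω ∂P', (Y' ω).jump (t i) = 0) →
          ConvergesInLaw P P'
            (fun n ω => ((fun i => X n ω (t i)), (H n ω).prodMk (Z n ω)))
            (fun ω => ((fun i => X' ω (t i)), (H' ω).prodMk (Z' ω)))) := by
  refine ⟨fun Z htight ε hε q => ?_, fun H Z Ω' _ P' _ Y' H' Z' X' K' hX' hsol hlaw => ?_⟩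
  · obtain ⟨hmeas, htight⟩ := htight
    rw [isTightMeasureSet_iff_exists_isCompact_measure_compl_le] at htight
    rw [ENNReal.tendsto_nhds_zero]
    intro η hη
    obtain ⟨K, hK, hKη⟩ := htight η hη
    obtain ⟨c₀, δ₀, hδ₀, h⟩ := exists_jakubowskiModulus_le_of_isCompact hopen hconv hne hK hε q
    filter_upwards [(gt_mem_nhds hδ₀).filter_mono nhdsWithin_le_nhds] with δ hδ
    refine limsup_le_of_le (by isBoundedDefault) ?_
    filter_upwards [PNat.eventually_le_cast c₀] with n hn
    refine le_trans ?_ (hKη _ ⟨n, rfl⟩)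
    refine le_trans (measure_mono_ae ?_) (Measure.le_map_apply (hmeas n) _)
    filter_upwards [hX n] with ω hω hbad hωK
    exact absurd (h _ hωK _ hn _ hω δ hδ.le) (not_le.2 hbad)
  · rw [convergesInLaw_iff] at hlaw
    have hsnd := Cadlag.measurable_map (continuous_snd
      (X := EuclideanSpace ℝ (Fin d)) (Y := EuclideanSpace ℝ (Fin d) × EuclideanSpace ℝ (Fin d)))
    have hHZ : ∀ n, AEMeasurable (fun ω => (H n ω).prodMk (Z n ω)) (P n) := fun n =>
      hsnd.comp_aemeasurable (hlaw.forall_aemeasurable n)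
    have hHZ' : AEMeasurable (fun ω => (H' ω).prodMk (Z' ω)) P' :=
      hsnd.comp_aemeasurable hlaw.aemeasurable_limit
    refine ⟨?_, fun m t ht => ?_⟩
    · rw [convergesInLaw_iff]
      refine hlaw.of_relation
        (fun n => Cadlag.aemeasurable_prodMk ((Cadlag.measurable_map
          (continuous_proj hconv hne)).comp_aemeasurable (hXmeas n)) (hHZ n))
        (Cadlag.aemeasurable_prodMk hX' hHZ')
        (fun n s u => ∃ x, PenalizedEq D ((n : ℕ) : ℝ) (s.map Prod.fst continuous_fst) x ∧
          u = (x.map (proj D) (continuous_proj hconv hne)).prodMk (s.map Prod.snd continuous_snd))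
        (fun n => (hX n).mono fun ω hω => ⟨X n ω, hω, rfl⟩) ?_
      filter_upwards [hsol] with ω hω U hU
      obtain ⟨N, ε, hε, hNU⟩ := Cadlag.mem_nhds_iff_skorokhodNhd.1 hU
      obtain ⟨M, η, c₀, hη, h⟩ :=
        exists_proj_mem_skorokhodNhd hopen hconv hne hω ((H' ω).prodMk (Z' ω)) N hε
      refine ⟨_, Cadlag.skorokhodNhd_mem_nhds _ M hη, (PNat.eventually_le_cast c₀).mono ?_⟩
      rintro n hn s hs _ ⟨x, hx, rfl⟩
      exact hNU (h s hs _ hn x hx)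
    · rw [convergesInLaw_iff]
      refine hlaw.of_relation
        (fun n => AEMeasurable.prodMk (aemeasurable_pi_lambda _ fun i =>
          (Cadlag.measurable_eval (t i)).comp_aemeasurable (hXmeas n)) (hHZ n))
        (AEMeasurable.prodMk (aemeasurable_pi_lambda _ fun i =>
          (Cadlag.measurable_eval (t i)).comp_aemeasurable hX') hHZ')
        (fun n s u => ∃ x, PenalizedEq D ((n : ℕ) : ℝ) (s.map Prod.fst continuous_fst) x ∧
          u = (fun i => x (t i), s.map Prod.snd continuous_snd))
        (fun n => (hX n).mono fun ω hω => ⟨X n ω, hω, rfl⟩) ?_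
      filter_upwards [hsol, ae_all_iff.2 ht] with ω hω hjump U hU
      obtain ⟨A, hA, B, hB, hAB⟩ := mem_nhds_prod_iff.1 hU
      obtain ⟨ε, hε, hεA⟩ := Metric.nhds_basis_closedBall.mem_iff.1 hA
      choose M η c₀ hη h using fun i =>
        exists_dist_eval_le hopen hconv hne hω ((H' ω).prodMk (Z' ω)) (hjump i) hε
      have hcont := Cadlag.continuous_map_snd (E := EuclideanSpace ℝ (Fin d))
        (F := EuclideanSpace ℝ (Fin d) × EuclideanSpace ℝ (Fin d))
      refine ⟨(⋂ i, (Cadlag.skorokhodNhd _ (M i) (η i))) ∩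
        (fun s => s.map Prod.snd continuous_snd) ⁻¹' B, inter_mem (iInter_mem.2 fun i =>
          Cadlag.skorokhodNhd_mem_nhds _ (M i) (hη i))
          (hcont.continuousAt.preimage_mem_nhds hB), ?_⟩
      filter_upwards [eventually_all.2 fun i => PNat.eventually_le_cast (c₀ i)] with n hn
      rintro s ⟨hs, hsB⟩ _ ⟨x, hx, rfl⟩
      refine hAB ⟨hεA ?_, hsB⟩
      rw [Metric.mem_closedBall, dist_pi_le_iff hε.le]
      exact fun i => h i s (mem_iInter.1 hs i) _ (hn i) x hx
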